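/- All rings are associative, unital and nontrivial. A ring $R$ is right (left) strongly dual Kasch if every simple right (left) $R$-module is a homomorphic image of its injective hull. A ring is quasi-Frobenius (QF) if it is Noetherian on at least one side and self-injective on at least one side. Let $R$ be a QF ring. Then there is a decomposition $1=\sum_{i=1}^{s}\sum_{l=1}^{n_i}e_{il}$ (with all $n_i\ge 1$) into orthogonal primitive idempotents such that $e_{il}R\cong e_{jm}R$ as right $R$-modules if and only if $i=j$. For any such decomposition put $e_i=e_{i1}$, $U_i=e_iR$, $\bar R=R/\mathrm{Jac}(R)$ and $S_i=\bar e_i\bar R$. There is exactly one permutation $\pi$ of $\{1,\dots,s\}$ with $\mathrm{soc}(U_i)\cong S_{\pi(i)}$ as right $R$-modules for all $i$; it is called the Nakayama permutation of $R$. The following are equivalent: (a) $R$ is right strongly dual Kasch; (b) $R$ is left strongly dual Kasch; (c) the Nakayama permutation $\pi$ (with respect to any, equivalently every, such decomposition) is the identity. In particular, let $A$ be a QF algebra over a field, and call $A$ weakly symmetric if its Nakayama permutation is the identity. Then $A$ is right strongly dual Kasch if and only if $A$ is weakly symmetric, and likewise $A$ is left strongly dual Kasch if and only if $A$ is weakly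 symmetric. -/

import Mathlib

universe u v

/-! Right `R`-modules are modules over the opposite ring `Rᵐᵒᵖ`; in particular right ideals of `R`
are terms of `Submodule Rᵐᵒᵖ R`. -/

section Modules

variable (A : Type u) [Ring A]

/-- `i : S → E` exhibits `E` as an injective hull of the `A`-module `S`: `E` is an injective module
and `i` is an essential monomorphism. -/
structure IsInjectiveHull {S E : Type u} [AddCommGroup S] [Module A S] [AddCommGroup E]
    [Module A E] (i : S →ₗ[A] E) : Prop where
  injective_module : Module.Injective A E
  injective : Function.Injective i
  essential : ∀ N : Submodule A E, N ≠ ⊥ → N ⊓ LinearMap.range i ≠ ⊥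

/-- Every simple `A`-module is a homomorphic image of its injective hull. -/
def SimplesAreImagesOfHulls : Prop :=
  ∀ (S : Type u) [AddCommGroup S] [Module A S], IsSimpleModule A S →
    ∃ (E : Type u) (_ : AddCommGroup E) (_ : Module A E) (i : S →ₗ[A] E),
      IsInjectiveHull A i ∧ ∃ f : E →ₗ[A] S, Function.Surjective f

/-- The socle of a module: the sum of its simple submodules. -/
def moduleSocle (M : Type v) [AddCommGroup M] [Module A M] : Submodule A M :=
  sSup {N : Submodule A M | IsSimpleModule A N}

end Modules

section Rings

variable (R : Type u) [Ring R]

/-- Every simple right `R`-module is a homomorphic image of its injective hull. -/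
def IsRightStronglyDualKasch : Prop := SimplesAreImagesOfHulls Rᵐᵒᵖ

/-- Every simple left `R`-module is a homomorphic image of its injective hull. -/
def IsLeftStronglyDualKasch : Prop := SimplesAreImagesOfHulls R

/-- A quasi-Frobenius ring: Noetherian on at least one side and self-injective on at least one
side. -/
def IsQuasiFrobenius : Prop :=
  (IsNoetherian Rᵐᵒᵖ R ∨ IsNoetherian R R) ∧ (Module.Injective Rᵐᵒᵖ R ∨ Module.Injective R R)

variable {R}

/-- A primitive idempotent: a nonzero idempotent that is not the sum of two nonzero orthogonal
idempotents. -/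
def IsPrimitiveIdempotent (e : R) : Prop :=
  IsIdempotentElem e ∧ e ≠ 0 ∧
    ∀ a b : R, IsIdempotentElem a → IsIdempotentElem b → a * b = 0 → b * a = 0 → e = a + b →
      a = 0 ∨ b = 0

/-- The principal right ideal `eR`. -/
def principalRight (e : R) : Submodule Rᵐᵒᵖ R := Submodule.span Rᵐᵒᵖ {e}

/-- The right `R`-module `ē R̄`, where `R̄ = R / Jac R` and `ē` is the class of `e`
(the Jacobson radical is taken here as the intersection of the maximal right ideals). -/
def residueRight (e : R) : Submodule Rᵐᵒᵖ (R ⧸ Module.jacobson Rᵐᵒᵖ R) :=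
  Submodule.span Rᵐᵒᵖ {Submodule.Quotient.mk e}

variable (R)

/-- A decomposition `1 = e₁₁ + ⋯ + e₁ₙ₁ + ⋯ + eₛ₁ + ⋯ + eₛₙₛ` of the identity into orthogonal
primitive idempotents, grouped by the isomorphism classes of the right ideals `eᵢₗR`. -/
structure PrincipalDecomposition where
  /-- the number of isomorphism classes -/
  s : ℕ
  /-- the number `nᵢ` of idempotents in each class -/
  mult : Fin s → ℕ
  mult_pos : ∀ i, 0 < mult i
  /-- the idempotents `eᵢₗ` -/
  idem : (Σ i : Fin s, Fin (mult i)) → R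
  complete : CompleteOrthogonalIdempotents idem
  primitive : ∀ x, IsPrimitiveIdempotent (idem x)
  iso : ∀ (i : Fin s) (l l' : Fin (mult i)),
    Nonempty (principalRight (idem ⟨i, l⟩) ≃ₗ[Rᵐᵒᵖ] principalRight (idem ⟨i, l'⟩))
  not_iso : ∀ (i j : Fin s), i ≠ j → ∀ (l : Fin (mult i)) (m : Fin (mult j)),
    ¬ Nonempty (principalRight (idem ⟨i, l⟩) ≃ₗ[Rᵐᵒᵖ] principalRight (idem ⟨j, m⟩))

variable {R}

namespace PrincipalDecomposition

/-- The representative `eᵢ = eᵢ₁` of the `i`-th class. -/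
def rep (D : PrincipalDecomposition R) (i : Fin D.s) : R := D.idem ⟨i, ⟨0, D.mult_pos i⟩⟩

/-- The principal indecomposable right module `Uᵢ = eᵢR`. -/
abbrev U (D : PrincipalDecomposition R) (i : Fin D.s) : Submodule Rᵐᵒᵖ R :=
  principalRight (D.rep i)

/-- The right module `Sᵢ = ēᵢR̄`. -/
abbrev S (D : PrincipalDecomposition R) (i : Fin D.s) :
    Submodule Rᵐᵒᵖ (R ⧸ Module.jacobson Rᵐᵒᵖ R) :=
  residueRight (D.rep i)

/-- `π` is the Nakayama permutation with respect to the decomposition: `soc Uᵢ ≅ S_{π i}` as right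
`R`-modules for all `i`. -/
def IsNakayamaPermutation (D : PrincipalDecomposition R) (π : Equiv.Perm (Fin D.s)) : Prop :=
  ∀ i, Nonempty (moduleSocle Rᵐᵒᵖ (D.U i) ≃ₗ[Rᵐᵒᵖ] D.S (π i))

end PrincipalDecomposition

variable (R)

/-- A QF algebra is weakly symmetric if its Nakayama permutation is the identity. (The choice of the
decomposition is immaterial.) -/
def IsWeaklySymmetric : Prop :=
  IsQuasiFrobenius R ∧
    ∃ (D : PrincipalDecomposition R) (π : Equiv.Perm (Fin D.s)), D.IsNakayamaPermutation π ∧ π = 1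

end Rings

/-! Over a QF ring each `U i = e_i R` is projective, injective and local. A local projective module
is determined by its simple top. A nonzero local, projective and injective module over a semiprimary
ring has a simple socle and is the injective hull of it, so it is determined by its socle as well.
Hence sending `i` to the index whose top is `soc (U i)` is an injective self-map of a finite set,
the permutation `π` (`IsPrincipalFamily.exists_perm`). As every simple module is a top and `U i` is
the hull of `soc (U i)`, being strongly dual Kasch means that every `U i` maps onto its own socle
(`IsPrincipalFamily.simplesAreImagesOfHulls_iff`), that is, `π = 1`.

For the left side, take `x ≠ 0` in `soc (eR)` with `x = xf`, where `e = e_i` and `f = e_{π i}`.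
Right self-injectivity makes `Rx` a simple submodule of `Rf`, and `ex = x`
(`exists_ne_zero_left_of_right`). So `Re` maps onto `soc (Rf)`: the left-hand permutation is the
inverse of `π`, and both are trivial together.

The one-sided definition of QF must first be made two-sided. In a left self-injective ring the
radical consists of the elements with essential left annihilator, and the quotient by it is von
Neumann regular. A chain condition on either side then gives a semiprimary ring
(`isSemiprimaryRing_of_injective`), and double annihilators carry injectivity to the other side
(`injective_right_of_injective_left`). -/

/-! ### Annihilator ideals. -/

section Annihilators

variable {A : Type u} [Ring A]

/-- The left annihilator of a subset of a ring, as a left ideal. -/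
def leftAnn (X : Set A) : Submodule A A where
  carrier := {a | ∀ x ∈ X, a * x = 0}
  add_mem' ha hb x hx := by rw [add_mul, ha x hx, hb x hx, add_zero]
  zero_mem' x _ := zero_mul x
  smul_mem' c a ha x hx := by rw [smul_eq_mul, mul_assoc, ha x hx, mul_zero]

/-- The right annihilator of a subset of a ring, as a right ideal. -/
def rightAnn (X : Set A) : Submodule Aᵐᵒᵖ A where
  carrier := {a | ∀ x ∈ X, x * a = 0}
  add_mem' ha hb x hx := by rw [mul_add, ha x hx, hb x hx, add_zero]
  zero_mem' x _ := mul_zero x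
  smul_mem' c a ha x hx := by
    rw [← MulOpposite.op_unop c, op_smul_eq_mul, ← mul_assoc, ha x hx, zero_mul]

theorem mem_leftAnn {X : Set A} {a : A} : a ∈ leftAnn X ↔ ∀ x ∈ X, a * x = 0 := Iff.rfl

theorem mem_leftAnn_singleton {a b : A} : a ∈ leftAnn {b} ↔ a * b = 0 := by
  simp [mem_leftAnn]

theorem leftAnn_anti {X Y : Set A} (h : X ⊆ Y) : leftAnn Y ≤ leftAnn X :=
  fun _ ha x hx ↦ ha x (h hx)

theorem Submodule.mul_mem_right_of_op {K : Submodule Aᵐᵒᵖ A} {a : A} (ha : a ∈ K) (b : A) :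
    a * b ∈ K := by
  simpa using K.smul_mem (MulOpposite.op b) ha

end Annihilators

/-! ### Left-right symmetry of the Jacobson radical. -/

section Jacobson

variable {A : Type u} [Ring A]

theorem Ring.mem_jacobson_iff_left {x : A} :
    x ∈ Ring.jacobson A ↔ ∀ y, ∃ z, z * (1 + y * x) = 1 := by
  rw [← Ideal.jacobson_bot, Ideal.mem_jacobson_iff]
  refine forall_congr' fun y ↦ exists_congr fun z ↦ ?_
  rw [Ideal.mem_bot, sub_eq_zero, mul_add, mul_one, add_comm, mul_assoc]

theorem Ring.isUnit_one_add_of_mem_jacobson {x : A} (hx : x ∈ Ring.jacobson A) :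
    IsUnit (1 + x) := by
  obtain ⟨z, hz⟩ := Ring.mem_jacobson_iff_left.1 hx 1
  rw [one_mul] at hz
  obtain ⟨w, hw⟩ := Ring.mem_jacobson_iff_left.1 hx (-z)
  have h1 : 1 + -z * x = z := by
    rw [neg_mul, ← sub_eq_add_neg, sub_eq_iff_eq_add, ← mul_one_add, hz]
  rw [h1] at hw
  have h2 : w = 1 + x := left_inv_eq_right_inv hw hz
  rw [h2] at hw
  exact isUnit_iff_exists_and_exists.2 ⟨⟨z, hw⟩, ⟨z, hz⟩⟩

/-- The right inverse `c` of `1 + x * y` is again of the form `1 + x * y'`, so it has a right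
inverse too and `1 + x * y` is a unit. An inverse of `1 + x * y` yields one of `1 + y * x`. -/
theorem Ring.mem_jacobson_of_right {x : A} (h : ∀ y, ∃ c, (1 + x * y) * c = 1) :
    x ∈ Ring.jacobson A := by
  refine Ring.mem_jacobson_iff_left.2 fun y ↦ ?_
  obtain ⟨c, hc⟩ := h y
  obtain ⟨d, hd⟩ := h (-(y * c))
  have h1 : 1 + x * -(y * c) = c := by
    rw [mul_neg, ← sub_eq_add_neg, sub_eq_iff_eq_add, ← mul_assoc, ← one_add_mul, hc]
  rw [h1] at hd
  have h2 : 1 + x * y = d := left_inv_eq_right_inv hc hd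
  rw [← h2] at hd
  refine ⟨1 - y * c * x, ?_⟩
  have : (1 - y * c * x) * (1 + y * x) = 1 + y * x - y * (c * (1 + x * y)) * x := by noncomm_ring
  rw [this, hd]; noncomm_ring

theorem Ring.mem_jacobson_iff_right {x : A} :
    x ∈ Ring.jacobson A ↔ ∀ y, ∃ c, (1 + x * y) * c = 1 := by
  refine ⟨fun hx y ↦ ?_, Ring.mem_jacobson_of_right⟩
  exact (Ring.isUnit_one_add_of_mem_jacobson (Ideal.mul_mem_right y _ hx)).exists_right_inv

theorem Ring.op_mem_jacobson_iff {x : A} :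
    MulOpposite.op x ∈ Ring.jacobson Aᵐᵒᵖ ↔ x ∈ Ring.jacobson A := by
  rw [Ring.mem_jacobson_iff_left, Ring.mem_jacobson_iff_right, MulOpposite.op_surjective.forall]
  refine forall_congr' fun y ↦ ?_
  rw [MulOpposite.op_surjective.exists]
  refine exists_congr fun z ↦ ?_
  rw [← MulOpposite.op_mul, ← MulOpposite.op_one, ← MulOpposite.op_add, ← MulOpposite.op_mul,
    MulOpposite.op_inj]

end Jacobson

/-! ### Noetherian von Neumann regular rings. -/

section Regular

variable {B : Type u} [Ring B]

/-- A left Noetherian von Neumann regular ring is semisimple. -/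
theorem isSemisimpleRing_of_regular [IsNoetherianRing B] (h : ∀ a : B, ∃ c, a * c * a = a) :
    IsSemisimpleRing B := by
  refine (isSemisimpleModule_iff B B).2 ⟨fun L ↦ ?_⟩
  obtain ⟨_, ⟨e, he, heL, rfl⟩, hmax⟩ := set_has_maximal_iff_noetherian.2
    (inferInstanceAs (IsNoetherian B B))
    {I : Submodule B B | ∃ e : B, IsIdempotentElem e ∧ e ∈ L ∧ I = Submodule.span B {e}}
    ⟨_, 0, IsIdempotentElem.zero, L.zero_mem, rfl⟩
  have hLe : ∀ x ∈ L, x * e = x := by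
    by_contra! hx
    obtain ⟨x, hxL, hx⟩ := hx
    obtain ⟨c, hc⟩ := h (x - x * e)
    have hye : (x - x * e) * e = 0 := by rw [sub_mul, mul_assoc, he.eq, sub_self]
    set y := x - x * e with hy
    have hyL : y ∈ L := L.sub_mem hxL (L.smul_mem x heL)
    have hy0 : y ≠ 0 := fun h0 ↦ hx (sub_eq_zero.1 h0).symm
    obtain ⟨g, hg⟩ : ∃ g, g = c * y := ⟨_, rfl⟩
    have hge : g * e = 0 := by rw [hg, mul_assoc, hye, mul_zero]
    have hgg : g * g = g := by
      rw [hg, show c * y * (c * y) = c * (y * c * y) by noncomm_ring, hc]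
    have hyg : y * g = y := by rw [hg, ← mul_assoc, hc]
    have hgL : g ∈ L := hg ▸ L.smul_mem c hyL
    have hee : e * e = e := he
    have hef : e * (e + g - e * g) = e := by
      rw [mul_sub, mul_add, ← mul_assoc, hee]; abel
    have hgf : g * (e + g - e * g) = g := by
      rw [mul_sub, mul_add, ← mul_assoc, hge, hgg]; simp
    -- Since `g * e = 0`, this element is an idempotent fixing `e` and `g` under right
    -- multiplication, so it generates a left ideal containing both and contradicts maximality.
    refine hmax _ ⟨e + g - e * g, ?_, L.sub_mem (L.add_mem heL hgL) (L.smul_mem e hgL), rfl⟩ ?_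
    · rw [IsIdempotentElem, sub_mul, add_mul, mul_assoc e g, hef, hgf]
    · have hle : Submodule.span B {e} ≤ Submodule.span B {e + g - e * g} := by
        rw [Submodule.span_singleton_le_iff_mem, Submodule.mem_span_singleton]
        exact ⟨e, hef⟩
      refine lt_of_le_not_ge hle fun hge' ↦ hy0 ?_
      have : g ∈ Submodule.span B {e} :=
        hge' (Submodule.mem_span_singleton.2 ⟨g, hgf⟩)
      obtain ⟨t, ht⟩ := Submodule.mem_span_singleton.1 this
      have : g * e = g := by rw [← ht, smul_eq_mul, mul_assoc, hee]
      rw [hge] at this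
      rw [← hyg, ← this, mul_zero]
  refine ⟨Submodule.span B {1 - e}, ?_, ?_⟩
  · rw [Submodule.disjoint_def]
    intro x hx hx'
    obtain ⟨t, rfl⟩ := Submodule.mem_span_singleton.1 hx'
    rw [← hLe _ hx, smul_eq_mul, mul_assoc, sub_mul, one_mul, he.eq, sub_self, mul_zero]
  · rw [codisjoint_iff, Submodule.eq_top_iff']
    intro x
    have : x = x * e + x * (1 - e) := by noncomm_ring
    rw [this]
    exact Submodule.add_mem_sup (L.smul_mem x heL)
      (Submodule.smul_mem _ x (Submodule.mem_span_singleton_self _))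

end Regular

/-! ### Left self-injective rings: the radical and semiprimarity. -/

section SelfInjective

variable {A : Type u} [Ring A]

/-- By hypothesis `x • a ↦ x * b` is well defined on the cyclic submodule generated by `a` in `ι →
A`. Injectivity extends it to the whole free module, and `c` lists its values on the standard basis.
-/
theorem exists_sum_mul_of_forall_mul_eq_zero [Module.Injective A A] {ι : Type*} [Fintype ι]
    (a : ι → A) (b : A) (h : ∀ x, (∀ i, x * a i = 0) → x * b = 0) :
    ∃ c : ι → A, b = ∑ i, a i * c i := by
  classical
  let φ : A →ₗ[A] (ι → A) := LinearMap.toSpanSingleton A _ a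
  let ψ : A →ₗ[A] A := LinearMap.toSpanSingleton A _ b
  have hle : LinearMap.ker φ ≤ LinearMap.ker ψ := fun x hx ↦
    h x fun i ↦ congrFun (LinearMap.mem_ker.1 hx) i
  obtain ⟨f, hf⟩ := Module.Injective.extension_property A A (A ⧸ LinearMap.ker φ) (ι → A)
    ((LinearMap.ker φ).liftQ φ le_rfl) (LinearMap.ker_eq_bot.1
      (by rw [Submodule.ker_liftQ, Submodule.mkQ_map_self])) ((LinearMap.ker φ).liftQ ψ hle)
  have h1 : f a = b := by
    have := LinearMap.congr_fun hf (Submodule.Quotient.mk 1)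
    simpa [φ, ψ] using this
  refine ⟨fun i ↦ f (Pi.single i 1), ?_⟩
  rw [← h1]
  conv_lhs => rw [pi_eq_sum_univ' a]
  rw [map_sum]
  refine Finset.sum_congr rfl fun i _ ↦ ?_
  rw [map_smul, smul_eq_mul]

theorem exists_mul_of_forall_mul_eq_zero [Module.Injective A A]
    (a b : A) (h : ∀ x, x * a = 0 → x * b = 0) : ∃ c, b = a * c := by
  obtain ⟨c, hc⟩ := exists_sum_mul_of_forall_mul_eq_zero (fun _ : Unit ↦ a) b
    fun x hx ↦ h x (hx ())
  exact ⟨c (), by simpa using hc⟩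

/-- Over a left self-injective ring, right multiplication by `a` can be inverted on a left ideal
which meets the left annihilator of `a` trivially. -/
theorem exists_mul_mul_eq_self [Module.Injective A A] (a : A) (N : Submodule A A)
    (h : Disjoint N (leftAnn {a})) : ∃ c, ∀ n ∈ N, n * a * c = n := by
  let φ : N →ₗ[A] A := (LinearMap.toSpanSingleton A A a) ∘ₗ N.subtype
  have hφ : Function.Injective φ := by
    rw [← LinearMap.ker_eq_bot, Submodule.eq_bot_iff]
    intro n hn
    have := Submodule.disjoint_def.1 h n n.2 (mem_leftAnn_singleton.2 hn)
    exact Subtype.ext this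
  obtain ⟨f, hf⟩ := Module.Injective.extension_property A A N A φ hφ N.subtype
  refine ⟨f 1, fun n hn ↦ ?_⟩
  have := LinearMap.congr_fun hf ⟨n, hn⟩
  simp only [φ, LinearMap.comp_apply, Submodule.subtype_apply,
    LinearMap.toSpanSingleton_apply, smul_eq_mul] at this
  rw [← smul_eq_mul, ← map_smul, smul_eq_mul, mul_one, this]

/-- A left ideal is essential if it meets every nonzero left ideal nontrivially. -/
def IsEssentialLeft (L : Submodule A A) : Prop := ∀ N : Submodule A A, Disjoint N L → N = ⊥

/-- If `N` misses the annihilator, then `n * a * c = n` on `N`, so `N` is killed by `1 - a * c`,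
which is a unit. -/
theorem isEssentialLeft_leftAnn_of_mem_jacobson [Module.Injective A A] {a : A}
    (ha : a ∈ Ring.jacobson A) : IsEssentialLeft (leftAnn {a}) := by
  intro N hN
  obtain ⟨c, hc⟩ := exists_mul_mul_eq_self a N hN
  have hu : IsUnit (1 + a * (-c)) :=
    Ring.isUnit_one_add_of_mem_jacobson (Ideal.mul_mem_right _ _ ha)
  rw [Submodule.eq_bot_iff]
  intro n hn
  have : n * (1 + a * -c) = 0 := by
    have : n * (1 + a * -c) = n - n * a * c := by noncomm_ring
    rw [this, hc n hn, sub_self]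
  exact (hu.mul_left_eq_zero).1 this

/-- The left annihilators of `z` and `1 + z * y` meet in zero, so essentiality makes the latter
vanish; self-injectivity then gives `1 + z * y` a right inverse. -/
theorem mem_jacobson_of_isEssentialLeft_leftAnn [Module.Injective A A] {z : A}
    (hz : IsEssentialLeft (leftAnn {z})) : z ∈ Ring.jacobson A := by
  refine Ring.mem_jacobson_of_right fun y ↦ ?_
  have h0 : leftAnn {1 + z * y} = ⊥ := by
    refine hz _ (Submodule.disjoint_def.2 fun x hx hx' ↦ ?_)
    rw [mem_leftAnn_singleton] at hx hx'
    rwa [mul_add, mul_one, ← mul_assoc, hx', zero_mul, add_zero] at hx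
  obtain ⟨c, hc⟩ := exists_mul_of_forall_mul_eq_zero (1 + z * y) 1 fun x hx ↦ by
    rw [mul_one]
    exact (Submodule.eq_bot_iff _).1 h0 x (mem_leftAnn_singleton.2 hx)
  exact ⟨c, hc.symm⟩

theorem exists_maximal_disjoint (L : Submodule A A) :
    ∃ N : Submodule A A, Disjoint N L ∧ ∀ N', N ≤ N' → Disjoint N' L → N' = N := by
  obtain ⟨N, -, hN⟩ := zorn_le_nonempty₀ {N : Submodule A A | Disjoint N L}
    (fun c hc hchain y hy ↦ ⟨sSup c,
      (hchain.directedOn.disjoint_sSup_left).2 fun b hb ↦ hc hb, fun z hz ↦ le_sSup hz⟩)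
    ⊥ disjoint_bot_left
  exact ⟨N, hN.prop, fun N' hle hd ↦ (hN.eq_of_le hd hle).symm⟩

/-- Regularity modulo the radical: if `c` inverts right multiplication by `a` on a maximal `N`
disjoint from `leftAnn {a}`, then `a - a * c * a` is killed by `N ⊔ leftAnn {a}`, which is
essential. -/
theorem exists_sub_mul_mul_mem_jacobson [Module.Injective A A] (a : A) :
    ∃ c, a - a * c * a ∈ Ring.jacobson A := by
  obtain ⟨N, hN, hmax⟩ := exists_maximal_disjoint (leftAnn {a})
  obtain ⟨c, hc⟩ := exists_mul_mul_eq_self a N hN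
  refine ⟨c, mem_jacobson_of_isEssentialLeft_leftAnn fun M hM ↦ ?_⟩
  have hle : N ⊔ leftAnn {a} ≤ leftAnn {a - a * c * a} := by
    refine sup_le (fun n hn ↦ ?_) fun n hn ↦ ?_ <;> rw [mem_leftAnn_singleton] at *
    · rw [mul_sub, ← mul_assoc, ← mul_assoc, hc n hn, sub_self]
    · rw [mul_sub, ← mul_assoc, ← mul_assoc, hn, zero_mul, zero_mul, sub_zero]
  have hd : Disjoint (M ⊔ N) (leftAnn {a}) :=
    Disjoint.disjoint_sup_left_of_disjoint_sup_right hN (hM.mono_right hle)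
  have hMN : M ≤ N := by
    rw [← hmax _ le_sup_right hd]
    exact le_sup_left
  exact disjoint_self.1 (hM.mono_right ((hMN.trans le_sup_left).trans hle))

/-- Let the left annihilators of the powers of `J` stabilise at `J ^ n ≠ 0`, and choose `a` not
killing `J ^ n` with `leftAnn {a}` maximal. For `b ∈ J` the essential `leftAnn {b}` meets `A a`, so
`leftAnn {a * b}` is strictly larger and `a * b` kills `J ^ n`. Thus `a` kills `J ^ (n + 1)`, hence
`J ^ n`, a contradiction. -/
theorem isNilpotent_jacobson_of_isNoetherianRing [Module.Injective A A] [IsNoetherianRing A] :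
    IsNilpotent (Ring.jacobson A) := by
  set J := Ring.jacobson A with hJ
  obtain ⟨n, hn⟩ := monotone_stabilizes_iff_noetherian.2 (inferInstanceAs (IsNoetherian A A))
    ⟨fun n ↦ leftAnn ((J ^ n : Ideal A) : Set A),
      fun m n hmn ↦ leftAnn_anti (Ideal.pow_le_pow_right hmn)⟩
  replace hn : leftAnn ((J ^ n : Ideal A) : Set A) = leftAnn ((J ^ (n + 1) : Ideal A) : Set A) :=
    hn (n + 1) n.le_succ
  refine ⟨n, ?_⟩
  by_contra hne
  obtain ⟨_, ⟨a, ha, rfl⟩, hmax⟩ := set_has_maximal_iff_noetherian.2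
    (inferInstanceAs (IsNoetherian A A))
    {I : Submodule A A | ∃ a, a ∉ leftAnn ((J ^ n : Ideal A) : Set A) ∧ I = leftAnn {a}} (by
      refine ⟨_, 1, fun h1 ↦ hne ?_, rfl⟩
      rw [Ideal.zero_eq_bot, Submodule.eq_bot_iff]
      intro x hx
      simpa using h1 x hx)
  refine ha ?_
  rw [hn, mem_leftAnn]
  have key : ∀ b ∈ J, a * b ∈ leftAnn ((J ^ n : Ideal A) : Set A) := by
    intro b hb
    by_contra hab
    refine hmax _ ⟨a * b, hab, rfl⟩ (lt_of_le_not_ge ?_ fun hge ↦ ?_)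
    · intro x hx
      rw [mem_leftAnn_singleton] at *
      rw [← mul_assoc, hx, zero_mul]
    · have hd : Disjoint (Submodule.span A {a}) (leftAnn {b}) := by
        rw [Submodule.disjoint_def]
        intro x hx hxb
        obtain ⟨t, rfl⟩ := Submodule.mem_span_singleton.1 hx
        rw [mem_leftAnn_singleton, smul_eq_mul, mul_assoc] at hxb
        exact mem_leftAnn_singleton.1 (hge (mem_leftAnn_singleton.2 hxb))
      have := isEssentialLeft_leftAnn_of_mem_jacobson hb _ hd
      rw [Submodule.span_singleton_eq_bot] at this
      exact ha (this ▸ Submodule.zero_mem _)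
  intro x hx
  rw [SetLike.mem_coe, Ideal.IsTwoSided.pow_succ, ← smul_eq_mul] at hx
  refine Submodule.smul_induction_on hx (fun b hb y hy ↦ ?_) fun y z hy hz ↦ ?_
  · rw [smul_eq_mul, ← mul_assoc]
    exact key b hb y hy
  · rw [mul_add, hy, hz, add_zero]

/-- Over a left self-injective ring finitely generated right ideals are right annihilators. -/
theorem Submodule.FG.mem_of_forall_leftAnn [Module.Injective A A] {K : Submodule Aᵐᵒᵖ A}
    (hK : K.FG) {b : A} (h : ∀ x ∈ leftAnn (K : Set A), x * b = 0) : b ∈ K := by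
  obtain ⟨s, rfl⟩ := hK
  obtain ⟨c, rfl⟩ := exists_sum_mul_of_forall_mul_eq_zero (fun i : s ↦ (i : A)) b fun x hx ↦ by
    refine h x fun y hy ↦ ?_
    refine Submodule.span_induction (fun z hz ↦ hx ⟨z, hz⟩) (mul_zero x)
      (fun y z _ _ hy hz ↦ by rw [mul_add, hy, hz, add_zero]) (fun r y _ hy ↦ ?_) hy
    rw [← MulOpposite.op_unop r, op_smul_eq_mul, ← mul_assoc, hy, zero_mul]
  exact Submodule.sum_mem _ fun i _ ↦ Submodule.mul_mem_right_of_op (Submodule.subset_span i.2) _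

/-- A two-sided ideal, regarded as a right ideal. -/
def Ideal.toRight (I : Ideal A) [I.IsTwoSided] : Submodule Aᵐᵒᵖ A where
  carrier := I
  add_mem' := I.add_mem
  zero_mem' := I.zero_mem
  smul_mem' c a ha := by
    rw [← MulOpposite.op_unop c, op_smul_eq_mul]
    exact I.mul_mem_right _ ha

/-- The left annihilators of the powers of `J` are two-sided, so they stabilise as right ideals.
Finitely generated right ideals are recovered from their left annihilators, so the powers stabilise
too, and Nakayama's lemma finishes. -/
theorem isNilpotent_jacobson_of_isNoetherian_right [Module.Injective A A] [IsNoetherian Aᵐᵒᵖ A] :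
    IsNilpotent (Ring.jacobson A) := by
  set J := Ring.jacobson A with hJ
  let l (n : ℕ) : Submodule Aᵐᵒᵖ A :=
    { leftAnn ((J ^ n : Ideal A) : Set A) with
      smul_mem' := fun c a ha x hx ↦ by
        rw [← MulOpposite.op_unop c, op_smul_eq_mul, mul_assoc]
        exact ha _ (Ideal.mul_mem_left _ _ hx) }
  obtain ⟨n, hn⟩ := monotone_stabilizes_iff_noetherian.2 (inferInstanceAs (IsNoetherian Aᵐᵒᵖ A))
    ⟨l, fun m n hmn ↦ leftAnn_anti (X := ((J ^ n : Ideal A) : Set A))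
      (Ideal.pow_le_pow_right hmn)⟩
  replace hn : l n = l (n + 1) := hn (n + 1) n.le_succ
  have hle : (J ^ n).toRight ≤ (J ^ (n + 1)).toRight := by
    intro b hb
    refine (IsNoetherian.noetherian (J ^ (n + 1)).toRight).mem_of_forall_leftAnn fun x hx ↦ ?_
    have hx' : x ∈ l (n + 1) := hx
    rw [← hn] at hx'
    exact hx' b hb
  refine ⟨n, ?_⟩
  have h0 : (J ^ n).toRight = ⊥ := by
    refine (IsNoetherian.noetherian _).eq_bot_of_le_jacobson_smul (hle.trans fun b hb ↦ ?_)
    replace hb : b ∈ J ^ n * J := by rw [← Submodule.pow_succ]; exact hb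
    rw [← smul_eq_mul] at hb
    refine Submodule.smul_induction_on hb (fun x hx y hy ↦ ?_) fun y z hy hz ↦ add_mem hy hz
    rw [smul_eq_mul, ← op_smul_eq_mul]
    exact Submodule.smul_mem_smul (Ring.op_mem_jacobson_iff.2 hy) hx
  rw [Ideal.zero_eq_bot, Submodule.eq_bot_iff]
  exact fun x hx ↦ (Submodule.eq_bot_iff _).1 h0 x hx

theorem isNoetherianRing_op_of_isNoetherian [IsNoetherian Aᵐᵒᵖ A] : IsNoetherianRing Aᵐᵒᵖ :=
  isNoetherian_of_linearEquiv (MulOpposite.opLinearEquiv Aᵐᵒᵖ : A ≃ₗ[Aᵐᵒᵖ] Aᵐᵒᵖ)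

theorem isSemiprimaryRing_of_injective [Module.Injective A A]
    (h : IsNoetherian A A ∨ IsNoetherian Aᵐᵒᵖ A) : IsSemiprimaryRing A := by
  have hreg : ∀ a : A ⧸ Ring.jacobson A, ∃ c, a * c * a = a := by
    intro a
    obtain ⟨a, rfl⟩ := Ideal.Quotient.mk_surjective a
    obtain ⟨c, hc⟩ := exists_sub_mul_mul_mem_jacobson a
    refine ⟨Ideal.Quotient.mk _ c, ?_⟩
    rw [← map_mul, ← map_mul]
    exact (Ideal.Quotient.eq.2 hc).symm
  rcases h with h | h
  · have : IsNoetherianRing A := h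
    have : IsNoetherianRing (A ⧸ Ring.jacobson A) :=
      isNoetherianRing_of_surjective A _ (Ideal.Quotient.mk _) Ideal.Quotient.mk_surjective
    exact ⟨isSemisimpleRing_of_regular hreg, isNilpotent_jacobson_of_isNoetherianRing⟩
  · have := isNoetherianRing_op_of_isNoetherian (A := A)
    have : IsNoetherianRing (A ⧸ Ring.jacobson A)ᵐᵒᵖ :=
      isNoetherianRing_of_surjective Aᵐᵒᵖ _ (RingHom.op (Ideal.Quotient.mk (Ring.jacobson A)))
        (fun x ↦ by
          obtain ⟨y, hy⟩ := Ideal.Quotient.mk_surjective (MulOpposite.unop x)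
          exact ⟨MulOpposite.op y, MulOpposite.unop_injective hy⟩)
    refine ⟨isSemisimpleRing_mulOpposite_iff.1 (isSemisimpleRing_of_regular fun a ↦ ?_),
      isNilpotent_jacobson_of_isNoetherian_right⟩
    obtain ⟨c, hc⟩ := hreg a.unop
    exact ⟨MulOpposite.op c, MulOpposite.unop_injective (by simpa [mul_assoc] using hc)⟩

end SelfInjective

/-! ### Local modules and projective covers. -/

section LocalModules

/-- A module is local if it has a largest proper submodule. -/
def IsLocalModule (A : Type*) [Ring A] (M : Type*) [AddCommGroup M] [Module A M] : Prop :=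
  ∃ m : Submodule A M, m ≠ ⊤ ∧ ∀ N : Submodule A M, N ≠ ⊤ → N ≤ m

variable {A : Type*} [Ring A] {P P' S S' : Type*} [AddCommGroup P] [Module A P]
  [AddCommGroup P'] [Module A P'] [AddCommGroup S] [Module A S] [AddCommGroup S'] [Module A S']

theorem IsLocalModule.eq_top_or_eq_top (h : IsLocalModule A P) {N N' : Submodule A P}
    (hN : N ⊔ N' = ⊤) : N = ⊤ ∨ N' = ⊤ := by
  obtain ⟨m, hm, hmax⟩ := h
  by_contra! h'
  exact hm (top_le_iff.1 (hN ▸ sup_le (hmax _ h'.1) (hmax _ h'.2)))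

theorem IsLocalModule.nontrivial (h : IsLocalModule A P) : Nontrivial P := by
  obtain ⟨m, hm, -⟩ := h
  by_contra h'
  rw [not_nontrivial_iff_subsingleton] at h'
  exact hm (Subsingleton.elim _ _)

theorem IsLocalModule.of_linearEquiv (h : IsLocalModule A P) (e : P ≃ₗ[A] P') :
    IsLocalModule A P' := by
  obtain ⟨m, hm, hmax⟩ := h
  have key : ∀ N : Submodule A P', N.comap (e : P →ₗ[A] P') = ⊤ → N = ⊤ := fun N hN ↦ by
    rw [Submodule.eq_top_iff'] at hN ⊢
    intro x
    simpa using hN (e.symm x)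
  refine ⟨m.comap (e.symm : P' →ₗ[A] P), fun h ↦ hm ?_, fun N hN x hx ↦
    hmax _ (fun h ↦ hN (key N h)) (by simpa using hx)⟩
  rw [Submodule.eq_top_iff'] at h ⊢
  intro x
  simpa using h (e x)

theorem IsLocalModule.ker_eq_ker (h : IsLocalModule A P) [IsSimpleModule A S] [IsSimpleModule A S']
    {f : P →ₗ[A] S} {g : P →ₗ[A] S'} (hf : f ≠ 0) (hg : g ≠ 0) :
    LinearMap.ker f = LinearMap.ker g := by
  obtain ⟨m, hm, hmax⟩ := h
  have key : ∀ N : Submodule A P, IsCoatom N → N = m := fun N hN ↦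
    ((hmax N hN.1).eq_or_lt).resolve_right fun hlt ↦ hm (hN.2 _ hlt)
  rw [key _ (LinearMap.isCoatom_ker_of_surjective (LinearMap.surjective_of_ne_zero hf)),
    key _ (LinearMap.isCoatom_ker_of_surjective (LinearMap.surjective_of_ne_zero hg))]

theorem IsLocalModule.nonempty_equiv_of_ne_zero (h : IsLocalModule A P) [IsSimpleModule A S]
    [IsSimpleModule A S'] {f : P →ₗ[A] S} {g : P →ₗ[A] S'} (hf : f ≠ 0) (hg : g ≠ 0) :
    Nonempty (S ≃ₗ[A] S') :=
  ⟨(f.quotKerEquivOfSurjective (LinearMap.surjective_of_ne_zero hf)).symm ≪≫ₗ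
    Submodule.quotEquivOfEq _ _ (h.ker_eq_ker hf hg) ≪≫ₗ
    g.quotKerEquivOfSurjective (LinearMap.surjective_of_ne_zero hg)⟩

/-- The surjection splits, and a local module is not a sum of two proper submodules; so the section
is onto, the kernel being proper. -/
theorem IsLocalModule.injective_of_surjective (h : IsLocalModule A P) [Nontrivial P']
    [Module.Projective A P'] {f : P →ₗ[A] P'} (hf : Function.Surjective f) :
    Function.Injective f := by
  obtain ⟨g, hg⟩ := Module.projective_lifting_property f LinearMap.id hf
  have hfg : ∀ x, f (g x) = x := LinearMap.congr_fun hg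
  have hsup : LinearMap.range g ⊔ LinearMap.ker f = ⊤ := by
    rw [Submodule.eq_top_iff']
    intro x
    rw [← add_sub_cancel (g (f x)) x]
    exact Submodule.add_mem_sup ⟨f x, rfl⟩ (by simp [hfg])
  rcases h.eq_top_or_eq_top hsup with h | h
  · have hgs := LinearMap.range_eq_top.1 h
    intro x y hxy
    obtain ⟨x, rfl⟩ := hgs x
    obtain ⟨y, rfl⟩ := hgs y
    rw [hfg, hfg] at hxy
    rw [hxy]
  · obtain ⟨x, hx⟩ := exists_ne (0 : P')
    obtain ⟨y, rfl⟩ := hf x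
    exact absurd (LinearMap.mem_ker.1 (h ▸ Submodule.mem_top : y ∈ LinearMap.ker f)) hx

/-- Projective covers of a simple module are isomorphic. -/
theorem IsLocalModule.nonempty_equiv_of_projective (h : IsLocalModule A P)
    (h' : IsLocalModule A P') [Module.Projective A P] [Module.Projective A P']
    [IsSimpleModule A S] {f : P →ₗ[A] S} {f' : P' →ₗ[A] S} (hf : f ≠ 0) (hf' : f' ≠ 0) :
    Nonempty (P ≃ₗ[A] P') := by
  obtain ⟨g, hg⟩ := Module.projective_lifting_property f' f (LinearMap.surjective_of_ne_zero hf')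
  have hsurj : Function.Surjective g := by
    rw [← LinearMap.range_eq_top]
    have hsup : LinearMap.range g ⊔ LinearMap.ker f' = ⊤ := by
      rw [Submodule.eq_top_iff']
      intro x
      obtain ⟨y, hy⟩ := LinearMap.surjective_of_ne_zero hf (f' x)
      rw [← add_sub_cancel (g y) x]
      refine Submodule.add_mem_sup ⟨y, rfl⟩ ?_
      rw [LinearMap.mem_ker, map_sub, ← hy, ← hg, LinearMap.comp_apply, sub_self]
    exact (h'.eq_top_or_eq_top hsup).resolve_right fun h0 ↦ hf' (LinearMap.ker_eq_top.1 h0)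
  have := h'.nontrivial
  exact ⟨LinearEquiv.ofBijective g ⟨h.injective_of_surjective hsurj, hsurj⟩⟩

end LocalModules

/-! ### Injective hulls. -/

section Injective

variable {A : Type u} [Ring A] {E E' S : Type u} [AddCommGroup E] [Module A E]
  [AddCommGroup E'] [Module A E'] [AddCommGroup S] [Module A S]

theorem Module.Injective.of_retract [Module.Injective A E] (i : E' →ₗ[A] E) (p : E →ₗ[A] E')
    (h : ∀ x, p (i x) = x) : Module.Injective A E' where
  out X Y _ _ _ _ f hf g := by
    obtain ⟨k, hk⟩ := Module.Injective.out f hf (i ∘ₗ g)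
    exact ⟨p ∘ₗ k, fun x ↦ by simp [hk, h]⟩

theorem Module.Injective.of_linearEquiv [Module.Injective A E] (e : E ≃ₗ[A] E') :
    Module.Injective A E' :=
  .of_retract (e.symm : E' →ₗ[A] E) (e : E →ₗ[A] E') (by simp)

theorem IsInjectiveHull.injective_of_comp {i : S →ₗ[A] E} (hi : IsInjectiveHull A i)
    {F : Type*} [AddCommGroup F] [Module A F] {f : E →ₗ[A] F}
    (hf : Function.Injective (f ∘ₗ i)) : Function.Injective f := by
  rw [← LinearMap.ker_eq_bot]
  by_contra hne
  refine hi.essential _ hne ?_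
  rw [Submodule.eq_bot_iff]
  rintro _ ⟨hx, s, rfl⟩
  have : s = 0 := hf (by simpa using hx)
  rw [this, map_zero]

/-- Injective hulls are unique up to isomorphism. -/
theorem IsInjectiveHull.nonempty_equiv {i : S →ₗ[A] E} {i' : S →ₗ[A] E'}
    (hi : IsInjectiveHull A i) (hi' : IsInjectiveHull A i') : Nonempty (E ≃ₗ[A] E') := by
  have := hi.injective_module
  have := hi'.injective_module
  obtain ⟨f, hf⟩ := Module.Injective.out i hi.injective i'
  have hfi : Function.Injective f := hi.injective_of_comp (by
    rw [show f ∘ₗ i = i' from LinearMap.ext hf]; exact hi'.injective)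
  obtain ⟨g, hg⟩ := Module.Injective.out f hfi (LinearMap.id : E →ₗ[A] E)
  have hgi : Function.Injective g := hi'.injective_of_comp (by
    rw [show g ∘ₗ i' = i from LinearMap.ext fun s ↦ by simp [← hf, hg]]; exact hi.injective)
  exact ⟨LinearEquiv.ofBijective f ⟨hfi, fun y ↦ ⟨g y, hgi (by simp [hg])⟩⟩⟩

/-- An injective projective local module has at most one simple submodule. -/
theorem IsLocalModule.simple_unique (h : IsLocalModule A E) [Module.Projective A E]
    [Module.Injective A E] {S S' : Submodule A E} (hS : IsSimpleModule A S)
    (hS' : IsSimpleModule A S') : S = S' := by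
  by_contra hne
  rw [isSimpleModule_iff_isAtom] at hS hS'
  have hd : Disjoint S S' := hS.disjoint_of_ne hS' hne
  obtain ⟨k, hk⟩ := Module.Injective.out (S'.mkQ ∘ₗ S.subtype) (by
    rw [← LinearMap.ker_eq_bot, LinearMap.ker_comp, Submodule.ker_mkQ,
      ← Submodule.disjoint_iff_comap_eq_bot]
    exact hd) S.subtype
  have := h.nontrivial
  set φ : E →ₗ[A] E := k ∘ₗ S'.mkQ with hφ
  -- As `φ` and `1 - φ` sum to the identity, locality makes one of them surjective, hence injective.
  -- But `φ` kills `S'` and `1 - φ` kills `S`.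
  have hsup : LinearMap.range φ ⊔ LinearMap.range (LinearMap.id - φ) = ⊤ := by
    rw [Submodule.eq_top_iff']
    intro x
    rw [← add_sub_cancel (φ x) x]
    exact Submodule.add_mem_sup ⟨x, rfl⟩ ⟨x, rfl⟩
  rcases h.eq_top_or_eq_top hsup with h1 | h1
  · have := h.injective_of_surjective (LinearMap.range_eq_top.1 h1)
    refine hS'.1 ((Submodule.eq_bot_iff _).2 fun x hx ↦ this ?_)
    rw [map_zero, hφ, LinearMap.comp_apply, show S'.mkQ x = 0 from (Submodule.Quotient.mk_eq_zero S').2 hx, map_zero]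
  · have := h.injective_of_surjective (LinearMap.range_eq_top.1 h1)
    refine hS.1 ((Submodule.eq_bot_iff _).2 fun x hx ↦ this ?_)
    have := hk ⟨x, hx⟩
    simp only [LinearMap.comp_apply, Submodule.subtype_apply] at this
    rw [map_zero, LinearMap.sub_apply, LinearMap.id_apply, hφ, LinearMap.comp_apply, this, sub_self]

end Injective

/-- Induction along the radical filtration: look inside `J M` if it is nonzero; otherwise `M` is its
own quotient by `J M`. -/
theorem IsSemiprimaryRing.exists_simple_submodule (A : Type*) [Ring A] [IsSemiprimaryRing A]
    (M : Type u) [AddCommGroup M] [Module A M] [Nontrivial M] :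
    ∃ S : Submodule A M, IsSimpleModule A S := by
  have := IsSemiprimaryRing.induction A A M
    (P := fun M _ _ _ ↦ Nontrivial M → ∃ S : Submodule A M, IsSimpleModule A S)
    (fun M _ _ _ _ _ _ _ ↦ IsSemisimpleModule.exists_simple_submodule A M)
    (fun M _ _ _ _ h1 h2 _ ↦ by
      set N := Ring.jacobson A • (⊤ : Submodule A M)
      by_cases hN : Nontrivial N
      · obtain ⟨S, hS⟩ := h1 hN
        exact ⟨S.map N.subtype,
          .congr (Submodule.equivMapOfInjective _ N.injective_subtype S).symm⟩
      · rw [Submodule.nontrivial_iff_ne_bot, not_not] at hN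
        let e : (M ⧸ N) ≃ₗ[A] M := Submodule.quotEquivOfEqBot N hN
        obtain ⟨S, hS⟩ := h2 e.symm.injective.nontrivial
        exact ⟨S.map (e : (M ⧸ N) →ₗ[A] M),
          .congr (Submodule.equivMapOfInjective _ e.injective S).symm⟩)
  exact this ‹_›

/-! ### Socles of local projective injective modules. -/

section Socle

variable {A : Type u} [Ring A] {P P' : Type u} [AddCommGroup P] [Module A P]
  [AddCommGroup P'] [Module A P']

theorem IsLocalModule.moduleSocle_eq (h : IsLocalModule A P) [Module.Projective A P]
    [Module.Injective A P] {S : Submodule A P} (hS : IsSimpleModule A S) :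
    moduleSocle A P = S :=
  le_antisymm (sSup_le fun _ hN ↦ (h.simple_unique hN hS).le) (le_sSup hS)

theorem IsLocalModule.isSimpleModule_socle [IsSemiprimaryRing A] (h : IsLocalModule A P)
    [Module.Projective A P] [Module.Injective A P] : IsSimpleModule A (moduleSocle A P) := by
  have := h.nontrivial
  obtain ⟨S, hS⟩ := IsSemiprimaryRing.exists_simple_submodule A P
  rwa [h.moduleSocle_eq hS]

theorem IsLocalModule.isInjectiveHull_socle [IsSemiprimaryRing A] (h : IsLocalModule A P)
    [Module.Projective A P] [Module.Injective A P] :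
    IsInjectiveHull A (moduleSocle A P).subtype where
  injective_module := ‹_›
  injective := Submodule.injective_subtype _
  essential N hN := by
    have := Submodule.nontrivial_iff_ne_bot.2 hN
    obtain ⟨S, hS⟩ := IsSemiprimaryRing.exists_simple_submodule A N
    have hS' : IsSimpleModule A (S.map N.subtype) :=
      .congr (Submodule.equivMapOfInjective _ N.injective_subtype S).symm
    have hle : S.map N.subtype ≤ N := Submodule.map_subtype_le N S
    rw [Submodule.range_subtype, h.moduleSocle_eq hS', inf_eq_right.2 hle]
    exact (isSimpleModule_iff_isAtom.1 hS').1

theorem nonempty_equiv_of_moduleSocle [IsSemiprimaryRing A] (h : IsLocalModule A P)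
    (h' : IsLocalModule A P') [Module.Projective A P] [Module.Injective A P]
    [Module.Projective A P'] [Module.Injective A P']
    (e : moduleSocle A P ≃ₗ[A] moduleSocle A P') : Nonempty (P ≃ₗ[A] P') := by
  have h1 := h'.isInjectiveHull_socle
  refine h.isInjectiveHull_socle.nonempty_equiv
    (i' := (moduleSocle A P').subtype ∘ₗ (e : moduleSocle A P →ₗ[A] moduleSocle A P'))
    ⟨h1.injective_module, h1.injective.comp e.injective, fun N hN ↦ ?_⟩
  rw [LinearMap.range_comp, LinearEquiv.range, Submodule.map_top]
  exact h1.essential N hN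

end Socle

/-- A complete irredundant family of indecomposable injective projective modules. -/
structure IsPrincipalFamily (A : Type u) [Ring A] {ι : Type*} (U : ι → Type u)
    [∀ i, AddCommGroup (U i)] [∀ i, Module A (U i)] : Prop where
  projective : ∀ i, Module.Projective A (U i)
  injective : ∀ i, Module.Injective A (U i)
  isLocal : ∀ i, IsLocalModule A (U i)
  eq_of_equiv : ∀ i j, Nonempty (U i ≃ₗ[A] U j) → i = j
  exists_ne_zero : ∀ (S : Type u) [AddCommGroup S] [Module A S], IsSimpleModule A S →
    ∃ i, ∃ f : U i →ₗ[A] S, f ≠ 0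

/-! ### The permutation of a principal family and the dual Kasch condition. -/

namespace IsPrincipalFamily

variable {A : Type u} [Ring A] {ι : Type*} {U : ι → Type u}
  [∀ i, AddCommGroup (U i)] [∀ i, Module A (U i)]

theorem isSimpleModule_socle [IsSemiprimaryRing A] (hU : IsPrincipalFamily A U) (i : ι) : IsSimpleModule A (moduleSocle A (U i)) :=
  have := hU.projective i
  have := hU.injective i
  (hU.isLocal i).isSimpleModule_socle

theorem eq_of_ne_zero (hU : IsPrincipalFamily A U) {S : Type u} [AddCommGroup S] [Module A S] [IsSimpleModule A S] {i j : ι}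
    {f : U i →ₗ[A] S} {g : U j →ₗ[A] S} (hf : f ≠ 0) (hg : g ≠ 0) : i = j :=
  have := hU.projective i
  have := hU.projective j
  hU.eq_of_equiv i j ((hU.isLocal i).nonempty_equiv_of_projective (hU.isLocal j) hf hg)

theorem eq_of_socle_equiv [IsSemiprimaryRing A] (hU : IsPrincipalFamily A U) {i j : ι} (e : moduleSocle A (U i) ≃ₗ[A] moduleSocle A (U j)) : i = j :=
  have := hU.projective i
  have := hU.projective j
  have := hU.injective i
  have := hU.injective j
  hU.eq_of_equiv i j (nonempty_equiv_of_moduleSocle (hU.isLocal i) (hU.isLocal j) e)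

/-- If `soc (U i)` and `soc (U j)` are both the top of the same member, they are isomorphic, and so
are their hulls `U i` and `U j`. -/
theorem exists_perm [IsSemiprimaryRing A] [Finite ι] (hU : IsPrincipalFamily A U) :
    ∃ π : Equiv.Perm ι, ∀ i, ∃ f : U (π i) →ₗ[A] moduleSocle A (U i), f ≠ 0 := by
  choose p hp using fun i ↦ hU.exists_ne_zero _ (hU.isSimpleModule_socle i)
  have hinj : Function.Injective p := by
    intro i j hij
    have := hU.isSimpleModule_socle i
    have := hU.isSimpleModule_socle j
    obtain ⟨f, hf⟩ := hp i
    obtain ⟨g, hg⟩ : ∃ g : U (p i) →ₗ[A] moduleSocle A (U j), g ≠ 0 := hij ▸ hp j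
    obtain ⟨e⟩ := (hU.isLocal (p i)).nonempty_equiv_of_ne_zero hf hg
    exact hU.eq_of_socle_equiv e
  exact ⟨Equiv.ofBijective p (Finite.injective_iff_bijective.1 hinj), hp⟩

/-- Surjectivity of the permutation is what is used: the simple module is the top of some `U (π i)`,
hence is `soc (U i)`. -/
theorem exists_injective [IsSemiprimaryRing A] [Finite ι] (hU : IsPrincipalFamily A U) (S : Type u) [AddCommGroup S] [Module A S]
    [IsSimpleModule A S] : ∃ i, ∃ f : S →ₗ[A] U i, f ≠ 0 := by
  obtain ⟨π, hπ⟩ := hU.exists_perm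
  obtain ⟨j, g, hg⟩ := hU.exists_ne_zero S ‹_›
  obtain ⟨i, rfl⟩ := π.surjective j
  obtain ⟨f, hf⟩ := hπ i
  have := hU.isSimpleModule_socle i
  obtain ⟨e⟩ := (hU.isLocal (π i)).nonempty_equiv_of_ne_zero hg hf
  refine ⟨i, (moduleSocle A (U i)).subtype ∘ₗ (e : S →ₗ[A] _), fun h0 ↦ ?_⟩
  have := IsSimpleModule.nontrivial A S
  obtain ⟨x, hx⟩ := exists_ne (0 : S)
  have := LinearMap.congr_fun h0 x
  simp at this
  exact hx this

theorem simplesAreImagesOfHulls_iff [IsSemiprimaryRing A] (hU : IsPrincipalFamily A U) :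
    SimplesAreImagesOfHulls A ↔ ∀ i, ∃ f : U i →ₗ[A] moduleSocle A (U i), f ≠ 0 := by
  refine ⟨fun h i ↦ ?_, fun h S _ _ hS ↦ ?_⟩
  · have := hU.projective i
    have := hU.injective i
    have hs := hU.isSimpleModule_socle i
    obtain ⟨E, _, _, k, hk, f, hf⟩ := h _ hs
    obtain ⟨e⟩ := ((hU.isLocal i).isInjectiveHull_socle).nonempty_equiv hk
    refine ⟨f ∘ₗ (e : U i →ₗ[A] E), fun h0 ↦ ?_⟩
    have := IsSimpleModule.nontrivial A (moduleSocle A (U i))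
    obtain ⟨x, hx⟩ := exists_ne (0 : moduleSocle A (U i))
    obtain ⟨y, rfl⟩ := hf x
    obtain ⟨z, rfl⟩ := e.surjective y
    exact hx (LinearMap.congr_fun h0 z)
  · obtain ⟨j, g, hg⟩ := hU.exists_ne_zero S hS
    obtain ⟨f, hf⟩ := h j
    have := hU.projective j
    have := hU.injective j
    have hs := hU.isSimpleModule_socle j
    obtain ⟨e⟩ := (hU.isLocal j).nonempty_equiv_of_ne_zero hg hf
    have h1 := (hU.isLocal j).isInjectiveHull_socle
    refine ⟨U j, _, _, (moduleSocle A (U j)).subtype ∘ₗ (e : S →ₗ[A] _),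
      ⟨h1.injective_module, h1.injective.comp e.injective, fun N hN ↦ ?_⟩, g,
      LinearMap.surjective_of_ne_zero hg⟩
    rw [LinearMap.range_comp, LinearEquiv.range, Submodule.map_top]
    exact h1.essential N hN

end IsPrincipalFamily

/-! ### Primitive idempotents generate local modules. -/

section Primitive

variable {A : Type u} [Ring A]

theorem IsIdempotentElem.mem_span_singleton_iff {e x : A} (he : IsIdempotentElem e) :
    x ∈ Submodule.span A {e} ↔ x * e = x := by
  rw [Submodule.mem_span_singleton]
  refine ⟨?_, fun h ↦ ⟨x, h⟩⟩
  rintro ⟨t, rfl⟩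
  rw [smul_eq_mul, mul_assoc, he.eq]

/-- Right multiplication by an idempotent `e` as a map onto the left ideal generated by `e`. -/
def mulRightSpan (e : A) : A →ₗ[A] Submodule.span A {e} :=
  (LinearMap.toSpanSingleton A A e).codRestrict _ fun x ↦
    Submodule.smul_mem _ x (Submodule.mem_span_singleton_self e)

theorem IsIdempotentElem.mulRightSpan_coe {e : A} (he : IsIdempotentElem e)
    (x : Submodule.span A {e}) : mulRightSpan e x = x :=
  Subtype.ext (he.mem_span_singleton_iff.1 x.2)

theorem IsIdempotentElem.injective_span [Module.Injective A A] {e : A}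
    (he : IsIdempotentElem e) : Module.Injective A (Submodule.span A {e}) :=
  .of_retract (Submodule.subtype _) (mulRightSpan e) he.mulRightSpan_coe

theorem IsIdempotentElem.projective_span {e : A}
    (he : IsIdempotentElem e) : Module.Projective A (Submodule.span A {e}) :=
  .of_split (Submodule.subtype _) (mulRightSpan e) (LinearMap.ext he.mulRightSpan_coe)

theorem IsIdempotentElem.notMem_jacobson {e : A} (he : IsIdempotentElem e) (h0 : e ≠ 0) :
    e ∉ Ring.jacobson A := by
  intro h
  have hu := Ring.isUnit_one_add_of_mem_jacobson (neg_mem h)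
  rw [← sub_eq_add_neg] at hu
  exact h0 ((hu.mul_left_eq_zero).1 (by rw [mul_sub, mul_one, he.eq, sub_self]))

/-- If `h` is idempotent modulo a nil ideal, some multiple of `h` by an element commuting with `h`
is an idempotent which is nonzero unless `h` is nilpotent. -/
theorem exists_isIdempotentElem_mul {h : A} (hn : IsNilpotent (h * (1 - h)))
    (h0 : ¬ IsNilpotent h) : ∃ w, Commute h w ∧ IsIdempotentElem (h * w) ∧ h * w ≠ 0 := by
  obtain ⟨n, hn⟩ := hn
  have hc : Commute h (1 - h) := (Commute.one_right h).sub_right (Commute.refl h)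
  rw [hc.mul_pow] at hn
  rcases n with _ | n
  · have h1 : (1 : A) = 0 := by simpa using hn
    exact absurd ⟨1, by rw [← mul_one (h ^ 1), h1, mul_zero]⟩ h0
  set w := ∑ k ∈ Finset.range (n + 1), (1 - h) ^ k with hw
  have hhw : Commute h w := Commute.sum_right _ _ _ fun k _ ↦ hc.pow_right k
  have h1 : 1 - h * w = (1 - h) ^ (n + 1) := by
    have := mul_neg_geom_sum (1 - h) (n + 1)
    rw [sub_sub_cancel] at this
    rw [hw, this, sub_sub_cancel]
  have h2 : h ^ (n + 1) * (h * w) = h ^ (n + 1) := by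
    rw [← h1, mul_sub, mul_one, sub_eq_zero] at hn
    exact hn.symm
  have h3 : ∀ m, h ^ (n + 1) * (h * w) ^ m = h ^ (n + 1) := by
    intro m
    induction m with
    | zero => simp
    | succ m ih => rw [pow_succ (h * w) m, ← mul_assoc, ih, h2]
  have hhhw : Commute (h ^ (n + 1)) w := hhw.pow_left _
  -- The idempotent is `(h * w) ^ (n + 1)`: since `h * w = 1 - (1 - h) ^ (n + 1)`, multiplication by
  -- `h * w` fixes `h ^ (n + 1)`.
  refine ⟨h ^ n * w ^ (n + 1), ((Commute.refl h).pow_right n).mul_right (hhw.pow_right _), ?_, ?_⟩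
  · have h4 : (h * w) ^ (n + 1) = w ^ (n + 1) * h ^ (n + 1) := by
      rw [hhw.mul_pow, (hhhw.pow_right (n + 1)).eq]
    rw [← mul_assoc, ← pow_succ', ← hhw.mul_pow, IsIdempotentElem]
    conv_lhs => enter [1]; rw [h4]
    rw [mul_assoc, h3, h4]
  · rw [← mul_assoc, ← pow_succ', ← hhw.mul_pow]
    intro h4
    exact h0 ⟨n + 1, by rw [← h3 (n + 1), h4, mul_zero]⟩

/-- The largest proper submodule is the part of `A e` in the radical. If `N` contains `a` outside
the radical, regularity of the semisimple quotient gives `h = e * c * a`, idempotent modulo the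
radical and not nilpotent. A multiple of `h` is then a nonzero idempotent of `e A e`, equal to `e`
by primitivity, and it is a left multiple of `a`. -/
theorem IsPrimitiveIdempotent.isLocalModule [IsSemiprimaryRing A] {e : A}
    (he : IsPrimitiveIdempotent e) : IsLocalModule A (Submodule.span A {e}) := by
  obtain ⟨hi, h0, hprim⟩ := he
  refine ⟨Submodule.comap (Submodule.subtype _) (Ring.jacobson A), fun h ↦ ?_, fun N hN ↦ ?_⟩
  · exact hi.notMem_jacobson h0
      (Submodule.eq_top_iff'.1 h ⟨e, Submodule.mem_span_singleton_self e⟩)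
  contrapose! hN
  obtain ⟨⟨a, hae⟩, haN, haJ⟩ := SetLike.not_le_iff_exists.1 hN
  replace haJ : a ∉ Ring.jacobson A := haJ
  have hmul : ∀ c : A, ∃ h : c * a ∈ Submodule.span A {e}, (⟨c * a, h⟩ : Submodule.span A {e}) ∈ N :=
    fun c ↦ ⟨Submodule.smul_mem _ c hae, N.smul_mem c haN⟩
  have hss := IsSemiprimaryRing.isSemisimpleRing (R := A)
  obtain ⟨c, hc⟩ : ∃ c, a - a * c * a ∈ Ring.jacobson A := by
    obtain ⟨ε, hε, hspan⟩ := IsSemisimpleRing.ideal_eq_span_idempotent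
      (Ideal.span {Ideal.Quotient.mk (Ring.jacobson A) a})
    have h1 : Ideal.Quotient.mk (Ring.jacobson A) a ∈ Ideal.span {ε} :=
      hspan ▸ Ideal.mem_span_singleton_self _
    have h2 : ε ∈ Ideal.span {Ideal.Quotient.mk (Ring.jacobson A) a} :=
      hspan ▸ Ideal.mem_span_singleton_self _
    obtain ⟨c, hc⟩ := Ideal.mem_span_singleton'.1 h2
    obtain ⟨d, hd⟩ := Ideal.mem_span_singleton'.1 h1
    obtain ⟨c, rfl⟩ := Ideal.Quotient.mk_surjective c
    refine ⟨c, ?_⟩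
    rw [← Ideal.Quotient.eq, map_mul, map_mul, mul_assoc, hc, ← hd, mul_assoc, hε.eq]
  have hae' : a * e = a := hi.mem_span_singleton_iff.1 hae
  set h := e * c * a with hh
  have heh : e * h = h := by rw [hh, ← mul_assoc, ← mul_assoc, hi.eq]
  have hhe : h * e = h := by rw [hh, mul_assoc, hae']
  have hJ : h * (1 - h) ∈ Ring.jacobson A := by
    have : h * (1 - h) = e * c * (a - a * e * c * a) := by rw [hh]; noncomm_ring
    rw [this, hae']
    exact Ideal.mul_mem_left _ _ hc
  -- Modulo the radical `h` equals `h ^ 2`, so if one power lies in the radical then `h` does.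
  have hpow : ∀ n, h ^ n ∈ Ring.jacobson A → h ^ 1 ∈ Ring.jacobson A := by
    intro n
    induction n with
    | zero => exact fun hn ↦ by simpa using Ideal.mul_mem_left _ h hn
    | succ n ih =>
      rcases n with _ | n
      · exact id
      · intro hn
        refine ih ?_
        have : h ^ (n + 1) = h ^ n * (h * (1 - h)) + h ^ (n + 1 + 1) := by
          rw [pow_succ, pow_succ, pow_succ]; noncomm_ring
        rw [this]
        exact add_mem (Ideal.mul_mem_left _ _ hJ) hn
  have hnil : ∀ x ∈ Ring.jacobson A, IsNilpotent x := by
    obtain ⟨n, hn⟩ := IsSemiprimaryRing.isNilpotent (R := A)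
    intro x hx
    exact ⟨n, by simpa [hn] using Ideal.pow_mem_pow hx n⟩
  have hhnot : ¬ IsNilpotent h := by
    rintro ⟨n, hn⟩
    have h1 : h ∈ Ring.jacobson A := by
      rw [← pow_one h]; exact hpow n (hn ▸ zero_mem _)
    refine haJ ?_
    have : a = (a - a * c * a) + a * h := by
      rw [hh, ← mul_assoc, ← mul_assoc, hae']; noncomm_ring
    rw [this]
    exact add_mem hc (Ideal.mul_mem_left _ _ h1)
  obtain ⟨w, hcomm, hid, hne⟩ := exists_isIdempotentElem_mul (hnil _ hJ) hhnot
  set p := h * w with hp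
  have hep : e * p = p := by rw [hp, ← mul_assoc, heh]
  have hpe : p * e = p := by rw [hp, hcomm.eq, mul_assoc, hhe]
  have hpe' : e = p := by
    have h1 : e - p = 0 := by
      refine (hprim p (e - p) hid ?_ ?_ ?_ (add_sub_cancel p e).symm).resolve_left hne
      · rw [IsIdempotentElem, mul_sub, sub_mul, sub_mul, hi.eq, hep, hpe, hid.eq, sub_self,
          sub_zero]
      · rw [mul_sub, hpe, hid.eq, sub_self]
      · rw [sub_mul, hep, hid.eq, sub_self]
    exact sub_eq_zero.1 h1
  obtain ⟨h1, h2⟩ := hmul (w * (e * c))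
  have heq : w * (e * c) * a = e := by rw [mul_assoc, ← hh, ← hcomm.eq]; exact hpe'.symm
  rw [Submodule.eq_top_iff']
  rintro ⟨x, hx⟩
  have h3 := N.smul_mem x h2
  have h4 : x • (⟨w * (e * c) * a, h1⟩ : Submodule.span A {e}) = ⟨x, hx⟩ :=
    Subtype.ext ((congrArg (x * ·) heq).trans (hi.mem_span_singleton_iff.1 hx))
  rwa [h4] at h3

end Primitive

/-! ### Isomorphism and decomposition of idempotents. -/

section Idempotents

variable {A : Type u} [Ring A]

theorem IsIdempotentElem.exists_ne_zero_iff {e : A} (he : IsIdempotentElem e) {M : Type*}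
    [AddCommGroup M] [Module A M] :
    (∃ f : Submodule.span A {e} →ₗ[A] M, f ≠ 0) ↔ ∃ m : M, e • m ≠ 0 := by
  constructor
  · rintro ⟨f, hf⟩
    refine ⟨f ⟨e, Submodule.mem_span_singleton_self e⟩, fun h ↦ hf (LinearMap.ext ?_)⟩
    rintro ⟨x, hx⟩
    have h1 : (⟨x, hx⟩ : Submodule.span A {e}) =
        x • (e • ⟨e, Submodule.mem_span_singleton_self e⟩) :=
      Subtype.ext (by
        rw [Submodule.coe_smul, Submodule.coe_smul, smul_eq_mul, smul_eq_mul, he.eq,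
          he.mem_span_singleton_iff.1 hx])
    rw [h1, map_smul, map_smul, h, smul_zero, LinearMap.zero_apply]
  · rintro ⟨m, hm⟩
    refine ⟨LinearMap.toSpanSingleton A M m ∘ₗ Submodule.subtype _, fun h ↦ hm ?_⟩
    exact LinearMap.congr_fun h ⟨e, Submodule.mem_span_singleton_self e⟩

/-- Take for `a` and `b` the images of the generators under the isomorphism and its inverse. The
criterion makes sense on both sides, which is how left and right isomorphism classes are matched. -/
theorem nonempty_span_equiv_iff {e f : A} (he : IsIdempotentElem e) (hf : IsIdempotentElem f) :
    Nonempty (Submodule.span A {e} ≃ₗ[A] Submodule.span A {f}) ↔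
      ∃ a b : A, a * b = e ∧ b * a = f := by
  constructor
  · rintro ⟨φ⟩
    have key : ∀ {e f : A} (_ : IsIdempotentElem f)
        (φ : Submodule.span A {e} ≃ₗ[A] Submodule.span A {f}),
        (φ ⟨e, Submodule.mem_span_singleton_self e⟩ : A) *
          φ.symm ⟨f, Submodule.mem_span_singleton_self f⟩ = e := by
      intro e f hf φ
      set a := φ ⟨e, Submodule.mem_span_singleton_self e⟩ with ha
      have h1 : (a : A) • (⟨f, Submodule.mem_span_singleton_self f⟩ : Submodule.span A {f}) = a :=
        Subtype.ext (hf.mem_span_singleton_iff.1 a.2)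
      rw [← smul_eq_mul, ← Submodule.coe_smul, ← map_smul, h1, ha, LinearEquiv.symm_apply_apply]
    exact ⟨_, _, key hf φ, by simpa using key he φ.symm⟩
  · rintro ⟨a, b, hab, hba⟩
    have key : ∀ {e f a b : A} (_ : IsIdempotentElem e) (_ : IsIdempotentElem f) (_ : a * b = e)
        (_ : b * a = f) (x : Submodule.span A {e}), (x : A) * a ∈ Submodule.span A {f} := by
      intro e f a b he hf hab hba x
      rw [hf.mem_span_singleton_iff, ← hba, ← mul_assoc, mul_assoc (x : A) a b, hab,
        he.mem_span_singleton_iff.1 x.2]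
    let φ : Submodule.span A {e} →ₗ[A] Submodule.span A {f} :=
      (LinearMap.toSpanSingleton A A a ∘ₗ Submodule.subtype _).codRestrict _
        (key he hf hab hba)
    let ψ : Submodule.span A {f} →ₗ[A] Submodule.span A {e} :=
      (LinearMap.toSpanSingleton A A b ∘ₗ Submodule.subtype _).codRestrict _
        (key hf he hba hab)
    refine ⟨LinearEquiv.ofLinearMap φ ψ (LinearMap.ext fun x ↦ Subtype.ext ?_)
      (LinearMap.ext fun x ↦ Subtype.ext ?_)⟩
    · change (x : A) * b * a = x
      rw [mul_assoc, hba, hf.mem_span_singleton_iff.1 x.2]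
    · change (x : A) * a * b = x
      rw [mul_assoc, hab, he.mem_span_singleton_iff.1 x.2]

theorem isPrincipalFamily_span [Module.Injective A A] [IsSemiprimaryRing A] {ι : Type*} [Fintype ι]
    {mult : ι → ℕ} {e : (Σ i, Fin (mult i)) → A} (he : CompleteOrthogonalIdempotents e)
    (hprim : ∀ x, IsPrimitiveIdempotent (e x))
    (iso : ∀ i l l', Nonempty (Submodule.span A {e ⟨i, l⟩} ≃ₗ[A] Submodule.span A {e ⟨i, l'⟩}))
    (not_iso : ∀ i j, i ≠ j → ∀ l m,
      ¬ Nonempty (Submodule.span A {e ⟨i, l⟩} ≃ₗ[A] Submodule.span A {e ⟨j, m⟩}))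
    (r : ∀ i, Fin (mult i)) : IsPrincipalFamily A fun i ↦ Submodule.span A {e ⟨i, r i⟩} where
  projective i := (hprim _).1.projective_span
  injective i := (hprim _).1.injective_span
  isLocal i := (hprim _).isLocalModule
  eq_of_equiv i j h := by
    by_contra hij
    exact not_iso i j hij _ _ h
  exists_ne_zero S _ _ hS := by
    have := IsSimpleModule.nontrivial A S
    obtain ⟨s, hs⟩ := exists_ne (0 : S)
    obtain ⟨⟨i, l⟩, hx⟩ : ∃ x, e x • s ≠ 0 := by
      by_contra! h
      apply hs
      rw [← one_smul A s, ← he.complete, Finset.sum_smul]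
      exact Finset.sum_eq_zero fun x _ ↦ h x
    obtain ⟨f, hf⟩ := (hprim ⟨i, l⟩).1.exists_ne_zero_iff.2 ⟨s, hx⟩
    obtain ⟨φ⟩ := iso i (r i) l
    refine ⟨i, f ∘ₗ (φ : Submodule.span A {e ⟨i, r i⟩} →ₗ[A] Submodule.span A {e ⟨i, l⟩}),
      fun h ↦ hf (LinearMap.ext fun x ↦ ?_)⟩
    have := LinearMap.congr_fun h (φ.symm x)
    simpa using this

theorem IsIdempotentElem.exists_primitive_decomposition [IsSemiprimaryRing A] {e : A}
    (he : IsIdempotentElem e) : ∃ (κ : Type) (_ : Fintype κ) (f : κ → A),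
      OrthogonalIdempotents f ∧ (∀ k, IsPrimitiveIdempotent (f k)) ∧ ∑ k, f k = e := by
  have hss := IsSemiprimaryRing.isSemisimpleRing (R := A)
  let mk := Ideal.Quotient.mk (Ring.jacobson A)
  -- Induction on the left ideal generated by the image of `e` in the semisimple quotient. It
  -- shrinks strictly when `e` splits, because no nonzero idempotent lies in the radical.
  have key : ∀ I : Ideal (A ⧸ Ring.jacobson A), ∀ e : A, IsIdempotentElem e →
      Ideal.span {mk e} = I →
      ∃ (κ : Type) (_ : Fintype κ) (f : κ → A),
      OrthogonalIdempotents f ∧ (∀ k, IsPrimitiveIdempotent (f k)) ∧ ∑ k, f k = e := by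
    intro I
    induction I using WellFoundedLT.induction with
    | ind I ih =>
      rintro e he rfl
      by_cases h0 : e = 0
      · exact ⟨Empty, inferInstance, Empty.elim, ⟨fun i ↦ i.elim, fun i ↦ i.elim⟩,
          fun i ↦ i.elim, by simp [h0]⟩
      by_cases hp : IsPrimitiveIdempotent e
      · exact ⟨Unit, inferInstance, fun _ ↦ e,
          ⟨fun _ ↦ he, fun i j hij ↦ absurd (Subsingleton.elim i j) hij⟩, fun _ ↦ hp, by simp⟩
      simp only [IsPrimitiveIdempotent, not_and, not_forall, not_or] at hp
      obtain ⟨a, b, ha, hb, hab, hba, rfl, ha0, hb0⟩ := hp he h0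
      have lt : ∀ {a b : A}, IsIdempotentElem a → IsIdempotentElem b → a * b = 0 → b * a = 0 →
          b ≠ 0 → Ideal.span {mk a} < Ideal.span {mk (a + b)} := by
        intro a b ha hb hab hba hb0
        refine lt_of_le_not_ge ?_ fun hle ↦ hb.notMem_jacobson hb0 ?_
        · rw [Ideal.span_singleton_le_iff_mem, Ideal.mem_span_singleton']
          exact ⟨mk a, by rw [← map_mul, mul_add, ha.eq, hab, add_zero]⟩
        · obtain ⟨t, ht⟩ := Ideal.mem_span_singleton'.1
            ((Ideal.span_singleton_le_iff_mem _).1 hle)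
          have h1 : mk (a + b) * mk b = 0 := by
            rw [← ht, mul_assoc, ← map_mul, hab, map_zero, mul_zero]
          rw [← map_mul, add_mul, hab, hb.eq, zero_add] at h1
          exact Ideal.Quotient.eq_zero_iff_mem.1 h1
      obtain ⟨κ, _, f, hf, hfp, hfs⟩ := ih _ (lt ha hb hab hba hb0) a ha rfl
      obtain ⟨κ', _, g, hg, hgp, hgs⟩ := ih _ (add_comm b a ▸ lt hb ha hba hab ha0) b hb rfl
      have hmul : ∀ {κ : Type} [Fintype κ] {f : κ → A} {a : A}, OrthogonalIdempotents f →
          ∑ k, f k = a → ∀ k, f k * a = f k ∧ a * f k = f k := by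
        classical
        intro κ _ f a hf hs k
        rw [← hs, Finset.mul_sum, Finset.sum_mul]
        simp [hf.mul_eq]
      refine ⟨κ ⊕ κ', inferInstance, Sum.elim f g, ⟨?_, ?_⟩, ?_, ?_⟩
      · rintro (k | k)
        exacts [hf.idem k, hg.idem k]
      · rintro (k | k) (l | l) hkl
        · exact hf.ortho fun h ↦ hkl (h ▸ rfl)
        · change f k * g l = 0
          rw [← (hmul hf hfs k).1, ← (hmul hg hgs l).2, mul_assoc, ← mul_assoc a, hab, zero_mul,
            mul_zero]
        · change g k * f l = 0
          rw [← (hmul hg hgs k).1, ← (hmul hf hfs l).2, mul_assoc, ← mul_assoc b, hba, zero_mul,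
            mul_zero]
        · exact hg.ortho fun h ↦ hkl (h ▸ rfl)
      · rintro (k | k)
        exacts [hfp k, hgp k]
      · simp [hfs, hgs]
  exact key _ e he rfl

theorem nonempty_principalDecomposition (A : Type u) [Ring A] [IsSemiprimaryRing A] :
    Nonempty (PrincipalDecomposition A) := by
  classical
  obtain ⟨κ, _, f, hf, hfp, hfs⟩ :=
    (IsIdempotentElem.one : IsIdempotentElem (1 : A)).exists_primitive_decomposition
  let r : Setoid κ :=
    { r := fun x y ↦ Nonempty (principalRight (f x) ≃ₗ[Aᵐᵒᵖ] principalRight (f y))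
      iseqv := ⟨fun _ ↦ ⟨.refl _ _⟩, fun ⟨e⟩ ↦ ⟨e.symm⟩, fun ⟨e⟩ ⟨e'⟩ ↦ ⟨e ≪≫ₗ e'⟩⟩ }
  let q : κ → Fin (Fintype.card (Quotient r)) := fun x ↦ Fintype.equivFin _ (Quotient.mk r x)
  have hq : ∀ x y, q x = q y ↔
      Nonempty (principalRight (f x) ≃ₗ[Aᵐᵒᵖ] principalRight (f y)) := fun x y ↦
    (Fintype.equivFin _).injective.eq_iff.trans Quotient.eq
  let mult : Fin (Fintype.card (Quotient r)) → ℕ := fun i ↦ Fintype.card {x // q x = i}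
  let σ : (Σ i, Fin (mult i)) ≃ κ :=
    (Equiv.sigmaCongrRight fun i ↦ (Fintype.equivFin {x // q x = i}).symm).trans
      (Equiv.sigmaFiberEquiv q)
  have hσ : ∀ i l, q (σ ⟨i, l⟩) = i := fun i l ↦ ((Fintype.equivFin {x // q x = i}).symm l).2
  exact ⟨{
    s := _
    mult := mult
    mult_pos := fun i ↦ Fintype.card_pos_iff.2 (by
      obtain ⟨x, hx⟩ := Quotient.exists_rep ((Fintype.equivFin (Quotient r)).symm i)
      exact ⟨⟨x, by simp only [q, hx, Equiv.apply_symm_apply]⟩⟩)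
    idem := f ∘ σ
    complete := ⟨⟨fun x ↦ hf.idem _, fun x y hxy ↦ hf.ortho (σ.injective.ne hxy)⟩,
      (Equiv.sum_comp σ f).trans hfs⟩
    primitive := fun x ↦ hfp _
    iso := fun i l l' ↦ (hq _ _).1 ((hσ i l).trans (hσ i l').symm)
    not_iso := fun i j hij l m h ↦ hij (by
      rw [← hσ i l, ← hσ j m]
      exact (hq _ _).2 h) }⟩

end Idempotents

/-! ### Passage between right ideals and the opposite ring. -/

section Opposite

variable {A : Type u} [Ring A]

/-- The principal right ideal of `e` as a left ideal of the opposite ring. -/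
noncomputable def principalRightEquiv (e : A) :
    principalRight e ≃ₗ[Aᵐᵒᵖ] Submodule.span Aᵐᵒᵖ {MulOpposite.op e} :=
  (MulOpposite.opLinearEquiv Aᵐᵒᵖ : A ≃ₗ[Aᵐᵒᵖ] Aᵐᵒᵖ).submoduleMap (principalRight e) ≪≫ₗ
    LinearEquiv.ofEq _ _ (by
      rw [principalRight, Submodule.map_span, Set.image_singleton]; rfl)

theorem IsIdempotentElem.op {e : A} (he : IsIdempotentElem e) :
    IsIdempotentElem (MulOpposite.op e) :=
  congrArg MulOpposite.op he

theorem IsPrimitiveIdempotent.op {e : A} (he : IsPrimitiveIdempotent e) :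
    IsPrimitiveIdempotent (MulOpposite.op e) := by
  refine ⟨he.1.op, fun h ↦ he.2.1 (MulOpposite.op_injective h), fun a b ha hb hab hba h ↦ ?_⟩
  have := he.2.2 a.unop b.unop (congrArg MulOpposite.unop ha) (congrArg MulOpposite.unop hb)
    (congrArg MulOpposite.unop hba) (congrArg MulOpposite.unop hab) (congrArg MulOpposite.unop h)
  simpa using this

theorem CompleteOrthogonalIdempotents.op {κ : Type*} [Fintype κ] {e : κ → A}
    (he : CompleteOrthogonalIdempotents e) :
    CompleteOrthogonalIdempotents fun k ↦ MulOpposite.op (e k) where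
  idem k := (he.idem k).op
  ortho k l hkl := congrArg MulOpposite.op (he.ortho hkl.symm)
  complete := by
    rw [← Finset.op_sum, he.complete, MulOpposite.op_one]

theorem nonempty_principalRight_equiv_iff {e f : A} :
    Nonempty (principalRight e ≃ₗ[Aᵐᵒᵖ] principalRight f) ↔
      Nonempty (Submodule.span Aᵐᵒᵖ {MulOpposite.op e} ≃ₗ[Aᵐᵒᵖ]
        Submodule.span Aᵐᵒᵖ {MulOpposite.op f}) :=
  ⟨fun ⟨φ⟩ ↦ ⟨(principalRightEquiv e).symm ≪≫ₗ φ ≪≫ₗ principalRightEquiv f⟩,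
    fun ⟨φ⟩ ↦ ⟨principalRightEquiv e ≪≫ₗ φ ≪≫ₗ (principalRightEquiv f).symm⟩⟩

/-- For idempotents, `eA ≅ fA` as right modules if and only if `Ae ≅ Af` as left modules. -/
theorem nonempty_span_equiv_iff_principalRight {e f : A} (he : IsIdempotentElem e)
    (hf : IsIdempotentElem f) : Nonempty (Submodule.span A {e} ≃ₗ[A] Submodule.span A {f}) ↔
      Nonempty (principalRight e ≃ₗ[Aᵐᵒᵖ] principalRight f) := by
  rw [nonempty_principalRight_equiv_iff, nonempty_span_equiv_iff he hf,
    nonempty_span_equiv_iff he.op hf.op]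
  constructor
  · rintro ⟨a, b, hab, hba⟩
    exact ⟨MulOpposite.op b, MulOpposite.op a, congrArg MulOpposite.op hab,
      congrArg MulOpposite.op hba⟩
  · rintro ⟨a, b, hab, hba⟩
    exact ⟨b.unop, a.unop, congrArg MulOpposite.unop hab, congrArg MulOpposite.unop hba⟩

theorem IsPrincipalFamily.of_linearEquiv {ι : Type*} {U V : ι → Type u}
    [∀ i, AddCommGroup (U i)] [∀ i, Module A (U i)] [∀ i, AddCommGroup (V i)]
    [∀ i, Module A (V i)] (hU : IsPrincipalFamily A U) (e : ∀ i, U i ≃ₗ[A] V i) :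
    IsPrincipalFamily A V where
  projective i := have := hU.projective i; .of_equiv (e i)
  injective i := have := hU.injective i; .of_linearEquiv (e i)
  isLocal i := (hU.isLocal i).of_linearEquiv (e i)
  eq_of_equiv i j := fun ⟨φ⟩ ↦ hU.eq_of_equiv i j ⟨e i ≪≫ₗ φ ≪≫ₗ (e j).symm⟩
  exists_ne_zero S _ _ hS := by
    obtain ⟨i, f, hf⟩ := hU.exists_ne_zero S hS
    refine ⟨i, f ∘ₗ ((e i).symm : V i →ₗ[A] U i), fun h ↦ hf (LinearMap.ext fun x ↦ ?_)⟩
    simpa using LinearMap.congr_fun h (e i x)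

namespace PrincipalDecomposition

theorem isPrincipalFamily_left (D : PrincipalDecomposition A) [Module.Injective A A] [IsSemiprimaryRing A] :
    IsPrincipalFamily A fun i ↦ Submodule.span A {D.rep i} :=
  isPrincipalFamily_span D.complete D.primitive
    (fun i l l' ↦ (nonempty_span_equiv_iff_principalRight (D.primitive _).1
      (D.primitive _).1).2 (D.iso i l l'))
    (fun i j hij l m h ↦ D.not_iso i j hij l m ((nonempty_span_equiv_iff_principalRight
      (D.primitive _).1 (D.primitive _).1).1 h))
    fun i ↦ ⟨0, D.mult_pos i⟩

theorem isPrincipalFamily_right (D : PrincipalDecomposition A) [Module.Injective Aᵐᵒᵖ A] [IsSemiprimaryRing Aᵐᵒᵖ] :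
    IsPrincipalFamily Aᵐᵒᵖ fun i ↦ D.U i := by
  have : Module.Injective Aᵐᵒᵖ Aᵐᵒᵖ :=
    .of_linearEquiv (MulOpposite.opLinearEquiv Aᵐᵒᵖ : A ≃ₗ[Aᵐᵒᵖ] Aᵐᵒᵖ)
  exact (isPrincipalFamily_span D.complete.op (fun x ↦ (D.primitive x).op)
    (fun i l l' ↦ nonempty_principalRight_equiv_iff.1 (D.iso i l l'))
    (fun i j hij l m h ↦ D.not_iso i j hij l m (nonempty_principalRight_equiv_iff.2 h))
    fun i ↦ ⟨0, D.mult_pos i⟩).of_linearEquiv fun i ↦ (principalRightEquiv (D.rep i)).symm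

end PrincipalDecomposition

end Opposite

/-! ### Left-right symmetry of quasi-Frobenius rings. -/

section TwoSided

variable {A : Type u} [Ring A]

/-- A left self-injective semiprimary ring is left Kasch. -/
theorem exists_ne_zero_of_isSimpleModule [Module.Injective A A] [IsSemiprimaryRing A]
    (S : Type u) [AddCommGroup S] [Module A S] [IsSimpleModule A S] :
    ∃ f : S →ₗ[A] A, f ≠ 0 := by
  obtain ⟨D⟩ := nonempty_principalDecomposition A
  obtain ⟨i, f, hf⟩ := D.isPrincipalFamily_left.exists_injective S
  refine ⟨Submodule.subtype _ ∘ₗ f, fun h ↦ hf (LinearMap.ext fun x ↦ Subtype.ext ?_)⟩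
  exact LinearMap.congr_fun h x

/-- Over a left self-injective semiprimary ring every left ideal is a left annihilator. -/
theorem mem_of_forall_rightAnn [Module.Injective A A] [IsSemiprimaryRing A] {L : Submodule A A}
    {x : A} (h : ∀ c ∈ rightAnn (L : Set A), x * c = 0) : x ∈ L := by
  by_contra hx
  set y : A ⧸ L := L.mkQ x with hy
  have hy0 : y ≠ 0 := fun h0 ↦ hx ((Submodule.Quotient.mk_eq_zero L).1 h0)
  set C := Submodule.span A {y} with hC
  let y' : C := ⟨y, Submodule.mem_span_singleton_self y⟩
  have hnt : Nontrivial C := ⟨⟨y', 0, fun h0 ↦ hy0 (congrArg Subtype.val h0)⟩⟩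
  obtain ⟨N, hN, -⟩ := (eq_top_or_exists_le_coatom (⊥ : Submodule A C)).resolve_left bot_ne_top
  have := (isSimpleModule_iff_isCoatom (R := A)).2 hN
  -- A simple quotient of the cyclic module on `y` maps nontrivially to `A`. The extension `g` to `A
  -- ⧸ L` is right multiplication by an element annihilating `L`, so the hypothesis forces `g y =
  -- 0`, although `y` generates.
  obtain ⟨f, hf⟩ := exists_ne_zero_of_isSimpleModule (A := A) (C ⧸ N)
  obtain ⟨g, hg⟩ := Module.Injective.out C.subtype C.injective_subtype (f ∘ₗ N.mkQ)
  have hmul : ∀ a, g (L.mkQ a) = a * g (L.mkQ 1) := fun a ↦ by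
    rw [← smul_eq_mul, ← map_smul, ← map_smul, smul_eq_mul, mul_one]
  have hgy : g y = 0 := by
    rw [hy, hmul]
    refine h _ fun z hz ↦ ?_
    rw [← hmul, Submodule.mkQ_apply, (Submodule.Quotient.mk_eq_zero L).2 hz, map_zero]
  refine hf (LinearMap.ext fun z ↦ ?_)
  obtain ⟨⟨z, hz⟩, rfl⟩ := N.mkQ_surjective z
  have h1 := hg ⟨z, hz⟩
  obtain ⟨t, rfl⟩ := Submodule.mem_span_singleton.1 hz
  rw [LinearMap.zero_apply, ← LinearMap.comp_apply, ← h1, Submodule.subtype_apply, map_smul, hgy,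
    smul_zero]

/-- A finitely generated `K₀ ≤ K` with minimal left annihilator is all of `K`: adjoining `k ∈ K`
cannot shrink the annihilator, and `K₀` is determined by it. -/
theorem isNoetherian_right_of_isArtinianRing [Module.Injective A A] [IsArtinianRing A] :
    IsNoetherian Aᵐᵒᵖ A := by
  refine ⟨fun K ↦ ?_⟩
  obtain ⟨_, ⟨K₀, hK₀, hle, rfl⟩, hmin⟩ := IsArtinian.set_has_minimal
    {I : Submodule A A | ∃ K₀ : Submodule Aᵐᵒᵖ A, K₀.FG ∧ K₀ ≤ K ∧ I = leftAnn (K₀ : Set A)}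
    ⟨_, ⊥, Submodule.fg_bot, bot_le, rfl⟩
  suffices K ≤ K₀ from le_antisymm this hle ▸ hK₀
  intro k hk
  refine hK₀.mem_of_forall_leftAnn fun x hx ↦ ?_
  have hle' : leftAnn ((K₀ ⊔ Submodule.span Aᵐᵒᵖ {k} : Submodule Aᵐᵒᵖ A) : Set A) ≤
      leftAnn (K₀ : Set A) := leftAnn_anti (SetLike.coe_subset_coe.2 le_sup_left)
  have heq := (hle'.eq_or_lt).resolve_right (hmin _ ⟨_,
    hK₀.sup (Submodule.fg_span_singleton k), sup_le hle
      ((Submodule.span_singleton_le_iff_mem _ _).2 hk), rfl⟩)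
  rw [← heq] at hx
  exact hx k (Submodule.mem_sup_right (Submodule.mem_span_singleton_self k))

/-- For one generator `a`, the value `g a` is killed by the right annihilator of `a`, so it lies in
`A a`. For a sum, `c₁ - c₂` kills `K₁ ⊓ K₂`, and double annihilators split it into a part killing
`K₁` and a part killing `K₂`, by which `c₁` is corrected. -/
theorem Submodule.FG.exists_eq_mul [Module.Injective A A] [IsSemiprimaryRing A]
    {K : Submodule Aᵐᵒᵖ A} (hK : K.FG) (g : K →ₗ[Aᵐᵒᵖ] A) : ∃ c, ∀ x : K, g x = c * x := by
  induction K, hK using Submodule.fg_induction with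
  | singleton a =>
    have ha : a ∈ Submodule.span Aᵐᵒᵖ {a} := Submodule.mem_span_singleton_self a
    have hga : g ⟨a, ha⟩ ∈ Submodule.span A {a} := by
      refine mem_of_forall_rightAnn fun c hc ↦ ?_
      rw [← op_smul_eq_mul, ← map_smul]
      have h0 : MulOpposite.op c • (⟨a, ha⟩ : Submodule.span Aᵐᵒᵖ {a}) = 0 :=
        Subtype.ext (hc a (Submodule.mem_span_singleton_self a))
      rw [h0, map_zero]
    obtain ⟨c, hc⟩ := Submodule.mem_span_singleton.1 hga
    refine ⟨c, fun x ↦ ?_⟩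
    obtain ⟨t, ht⟩ := Submodule.mem_span_singleton.1 x.2
    have hx : x = t • ⟨a, ha⟩ := Subtype.ext ht.symm
    rw [hx, map_smul, ← hc, Submodule.coe_smul, ← MulOpposite.op_unop t, op_smul_eq_mul,
      op_smul_eq_mul, smul_eq_mul, mul_assoc]
  | sup K₁ K₂ hK₁ hK₂ ih₁ ih₂ =>
    obtain ⟨c₁, hc₁⟩ := ih₁ (g ∘ₗ Submodule.inclusion le_sup_left)
    obtain ⟨c₂, hc₂⟩ := ih₂ (g ∘ₗ Submodule.inclusion le_sup_right)
    have hmem : c₁ - c₂ ∈ leftAnn (K₁ : Set A) ⊔ leftAnn (K₂ : Set A) := by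
      refine mem_of_forall_rightAnn fun y hy ↦ ?_
      have h₁ : y ∈ K₁ := hK₁.mem_of_forall_leftAnn fun x hx ↦ hy x (Submodule.mem_sup_left hx)
      have h₂ : y ∈ K₂ := hK₂.mem_of_forall_leftAnn fun x hx ↦ hy x (Submodule.mem_sup_right hx)
      rw [sub_mul, ← hc₁ ⟨y, h₁⟩, ← hc₂ ⟨y, h₂⟩, sub_eq_zero]
      rfl
    obtain ⟨u, hu, v, hv, huv⟩ := Submodule.mem_sup.1 hmem
    refine ⟨c₁ - u, ?_⟩
    rintro ⟨x, hx⟩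
    obtain ⟨x₁, hx₁, x₂, hx₂, rfl⟩ := Submodule.mem_sup.1 hx
    have h : (⟨x₁ + x₂, hx⟩ : ↥(K₁ ⊔ K₂)) = Submodule.inclusion le_sup_left ⟨x₁, hx₁⟩ +
      Submodule.inclusion le_sup_right ⟨x₂, hx₂⟩ := rfl
    have h₁ := hc₁ ⟨x₁, hx₁⟩
    have h₂ := hc₂ ⟨x₂, hx₂⟩
    rw [LinearMap.comp_apply] at h₁ h₂
    have h₃ : c₁ - u = c₂ + v := by
      rw [sub_eq_iff_eq_add, add_assoc, add_comm v, huv]; abel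
    rw [h, map_add, h₁, h₂, ← h, mul_add]
    congr 1
    · rw [sub_mul, hu x₁ hx₁, sub_zero]
    · rw [h₃, add_mul, hv x₂ hx₂, add_zero]

theorem injective_right_of_isNoetherian [Module.Injective A A] [IsSemiprimaryRing A]
    [IsNoetherian Aᵐᵒᵖ A] : Module.Injective Aᵐᵒᵖ A := by
  refine Module.Baer.injective fun I g ↦ ?_
  let o : A ≃ₗ[Aᵐᵒᵖ] Aᵐᵒᵖ := MulOpposite.opLinearEquiv Aᵐᵒᵖ
  let K : Submodule Aᵐᵒᵖ A := Submodule.comap (o : A →ₗ[Aᵐᵒᵖ] Aᵐᵒᵖ) I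
  obtain ⟨c, hc⟩ := (IsNoetherian.noetherian K).exists_eq_mul
    (g ∘ₗ (o : A →ₗ[Aᵐᵒᵖ] Aᵐᵒᵖ).restrict fun x hx ↦ hx)
  exact ⟨LinearMap.toSpanSingleton Aᵐᵒᵖ A c, fun x hx ↦ (hc ⟨x.unop, hx⟩).symm⟩

theorem isNoetherian_right_of_injective [Module.Injective A A]
    (h : IsNoetherian A A ∨ IsNoetherian Aᵐᵒᵖ A) : IsNoetherian Aᵐᵒᵖ A := by
  have := isSemiprimaryRing_of_injective h
  rcases h with h | h
  · have : IsArtinianRing A := IsSemiprimaryRing.isNoetherian_iff_isArtinian.1 h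
    exact isNoetherian_right_of_isArtinianRing
  · exact h

theorem injective_right_of_injective_left [Module.Injective A A]
    (h : IsNoetherian A A ∨ IsNoetherian Aᵐᵒᵖ A) : Module.Injective Aᵐᵒᵖ A :=
  have := isSemiprimaryRing_of_injective h
  have := isNoetherian_right_of_injective h
  injective_right_of_isNoetherian

theorem isSemiprimaryRing_op_of_injective [Module.Injective A A]
    (h : IsNoetherian A A ∨ IsNoetherian Aᵐᵒᵖ A) : IsSemiprimaryRing Aᵐᵒᵖ := by
  have := injective_right_of_injective_left h
  have : Module.Injective Aᵐᵒᵖ Aᵐᵒᵖ :=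
    .of_linearEquiv (MulOpposite.opLinearEquiv Aᵐᵒᵖ : A ≃ₗ[Aᵐᵒᵖ] Aᵐᵒᵖ)
  have := isNoetherian_right_of_injective h
  exact isSemiprimaryRing_of_injective (.inl isNoetherianRing_op_of_isNoetherian)

theorem IsQuasiFrobenius.injective_left (h : IsQuasiFrobenius A) : Module.Injective A A := by
  obtain ⟨hn, hi | hi⟩ := h
  -- The right self-injective case is the left one for the opposite ring, carried back along the
  -- isomorphism with the double opposite.
  · have : Module.Injective Aᵐᵒᵖ Aᵐᵒᵖ :=
      .of_linearEquiv (MulOpposite.opLinearEquiv Aᵐᵒᵖ : A ≃ₗ[Aᵐᵒᵖ] Aᵐᵒᵖ)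
    have hn' : IsNoetherian Aᵐᵒᵖ Aᵐᵒᵖ ∨ IsNoetherian Aᵐᵒᵖᵐᵒᵖ Aᵐᵒᵖ := by
      refine hn.imp (fun h : IsNoetherian Aᵐᵒᵖ A ↦ isNoetherianRing_op_of_isNoetherian) fun h ↦ ?_
      have : IsNoetherianRing A := h
      have : IsNoetherianRing Aᵐᵒᵖᵐᵒᵖ := isNoetherianRing_of_ringEquiv A (RingEquiv.opOp A)
      exact isNoetherian_of_linearEquiv
        (MulOpposite.opLinearEquiv Aᵐᵒᵖᵐᵒᵖ : Aᵐᵒᵖ ≃ₗ[Aᵐᵒᵖᵐᵒᵖ] Aᵐᵒᵖᵐᵒᵖ).symm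
    have := injective_right_of_injective_left hn'
    have inj : Module.Injective Aᵐᵒᵖᵐᵒᵖ Aᵐᵒᵖᵐᵒᵖ :=
      .of_linearEquiv (MulOpposite.opLinearEquiv Aᵐᵒᵖᵐᵒᵖ : Aᵐᵒᵖ ≃ₗ[Aᵐᵒᵖᵐᵒᵖ] Aᵐᵒᵖᵐᵒᵖ)
    let e : Aᵐᵒᵖᵐᵒᵖ ≃+* A := (RingEquiv.opOp A).symm
    have := RingHomInvPair.of_ringEquiv e
    have := RingHomInvPair.symm (RingHomClass.toRingHom e) (RingHomClass.toRingHom e.symm)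
    let φ : Aᵐᵒᵖᵐᵒᵖ ≃ₛₗ[RingHomClass.toRingHom e] A := e.toSemilinearEquiv
    exact Module.Injective.of_ringEquiv e φ
  · exact hi

theorem IsQuasiFrobenius.injective_right (h : IsQuasiFrobenius A) : Module.Injective Aᵐᵒᵖ A :=
  have := h.injective_left
  injective_right_of_injective_left h.1.symm

theorem IsQuasiFrobenius.isSemiprimaryRing (h : IsQuasiFrobenius A) : IsSemiprimaryRing A :=
  have := h.injective_left
  isSemiprimaryRing_of_injective h.1.symm

theorem IsQuasiFrobenius.isSemiprimaryRing_op (h : IsQuasiFrobenius A) : IsSemiprimaryRing Aᵐᵒᵖ :=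
  have := h.injective_left
  isSemiprimaryRing_op_of_injective h.1.symm

end TwoSided

/-! ### The modules `S i` as tops of the modules `U i`. -/

section Top

theorem IsLocalModule.isSimpleModule_of_jacobson_eq_bot {A M : Type*} [Ring A] [AddCommGroup M]
    [Module A M] (h : IsLocalModule A M) (hJ : Module.jacobson A M = ⊥) : IsSimpleModule A M := by
  have := h.nontrivial
  obtain ⟨m, hm, hmax⟩ := h
  have hbot : m = ⊥ := by
    rw [← le_bot_iff, ← hJ]
    refine le_sInf fun c hc ↦ ?_
    by_contra hle
    have hlt : c < m := lt_of_le_of_ne (hmax c hc.1) fun h ↦ hle h.ge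
    exact hm (hc.2 _ hlt)
  have : IsSimpleOrder (Submodule A M) :=
    ⟨fun N ↦ or_iff_not_imp_right.2 fun hN ↦ le_bot_iff.1 (hbot ▸ hmax N hN)⟩
  exact ⟨⟩

theorem IsLocalModule.of_surjective {A M N : Type*} [Ring A] [AddCommGroup M]
    [Module A M] [AddCommGroup N] [Module A N] [Nontrivial N] (h : IsLocalModule A M)
    {f : M →ₗ[A] N} (hf : Function.Surjective f) : IsLocalModule A N := by
  obtain ⟨m, hm, hmax⟩ := h
  have hcomap : ∀ K : Submodule A N, K ≠ ⊤ → K.comap f ≤ m := fun K hK ↦ hmax _ fun h0 ↦ hK <| by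
    rw [← Submodule.map_comap_eq_of_surjective hf K, h0, Submodule.map_top,
      LinearMap.range_eq_top.2 hf]
  refine ⟨m.map f, fun h0 ↦ hm ?_, fun K hK ↦ ?_⟩
  · have hker : LinearMap.ker f ≤ m := by
      simpa using hcomap ⊥ bot_ne_top
    rw [← Submodule.comap_map_eq_self hker, h0, Submodule.comap_top]
  · rw [← Submodule.map_comap_eq_of_surjective hf K]
    exact Submodule.map_mono (hcomap K hK)

variable {R : Type u} [Ring R]

/-- The projection of the right ideal `eR` onto its image in `R` modulo the Jacobson radical. -/
def principalRightToResidue (e : R) : principalRight e →ₗ[Rᵐᵒᵖ] residueRight e :=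
  ((Module.jacobson Rᵐᵒᵖ R).mkQ ∘ₗ (principalRight e).subtype).codRestrict _ fun x ↦ by
    obtain ⟨t, ht⟩ := Submodule.mem_span_singleton.1 x.2
    rw [LinearMap.comp_apply, Submodule.subtype_apply, ← ht, map_smul]
    exact Submodule.smul_mem _ _ (Submodule.mem_span_singleton_self _)

theorem principalRightToResidue_surjective (e : R) :
    Function.Surjective (principalRightToResidue e) := by
  rintro ⟨x, hx⟩
  obtain ⟨t, rfl⟩ := Submodule.mem_span_singleton.1 hx
  exact ⟨⟨t • e, Submodule.smul_mem _ _ (Submodule.mem_span_singleton_self e)⟩, rfl⟩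

theorem IsPrimitiveIdempotent.nontrivial_residueRight {e : R} (he : IsPrimitiveIdempotent e) :
    Nontrivial (residueRight e) := by
  refine ⟨⟨⟨_, Submodule.mem_span_singleton_self _⟩, 0, fun h ↦ ?_⟩⟩
  have h1 : e ∈ Module.jacobson Rᵐᵒᵖ R :=
    (Submodule.Quotient.mk_eq_zero _).1 (congrArg Subtype.val h)
  let o : R ≃ₗ[Rᵐᵒᵖ] Rᵐᵒᵖ := MulOpposite.opLinearEquiv Rᵐᵒᵖ
  have h2 := Module.map_jacobson_le (o : R →ₗ[Rᵐᵒᵖ] Rᵐᵒᵖ) (Submodule.mem_map_of_mem h1)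
  exact he.1.op.notMem_jacobson (fun h ↦ he.2.1 (MulOpposite.op_injective h)) h2

theorem isSimpleModule_residueRight {e : R} (he : IsPrimitiveIdempotent e)
    (hl : IsLocalModule Rᵐᵒᵖ (principalRight e)) : IsSimpleModule Rᵐᵒᵖ (residueRight e) := by
  have := he.nontrivial_residueRight
  exact (hl.of_surjective (principalRightToResidue_surjective e)).isSimpleModule_of_jacobson_eq_bot
    (Module.jacobson_eq_bot_of_injective _ (Submodule.injective_subtype _)
      (Module.jacobson_quotient_jacobson _ _))

theorem principalRightToResidue_ne_zero {e : R} (he : IsPrimitiveIdempotent e) :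
    principalRightToResidue e ≠ 0 := by
  intro h
  have := he.nontrivial_residueRight
  obtain ⟨x, hx⟩ := exists_ne (0 : residueRight e)
  obtain ⟨y, rfl⟩ := principalRightToResidue_surjective e x
  exact hx (by rw [h, LinearMap.zero_apply])

end Top

/-! ### From right socles to left socles. -/

section LeftRight

variable {R : Type u} [Ring R]

theorem isSimpleModule_span_singleton {M : Type*} [AddCommGroup M] [Module R M] {x : M}
    (hx : x ≠ 0) (h : ∀ r : R, r • x ≠ 0 → ∃ t : R, t • r • x = x) :
    IsSimpleModule R (Submodule.span R {x}) := by
  refine isSimpleModule_iff_toSpanSingleton_surjective.2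
    ⟨⟨⟨x, Submodule.mem_span_singleton_self x⟩, 0, fun h0 ↦ hx (congrArg Subtype.val h0)⟩, ?_⟩
  rintro ⟨m, hm⟩ hm0 ⟨n, hn⟩
  obtain ⟨r, rfl⟩ := Submodule.mem_span_singleton.1 hm
  obtain ⟨s, rfl⟩ := Submodule.mem_span_singleton.1 hn
  obtain ⟨t, ht⟩ := h r fun h0 ↦ hm0 (Subtype.ext h0)
  refine ⟨s * t, Subtype.ext ?_⟩
  change (s * t) • r • x = s • x
  rw [mul_smul, ht]

/-- Over a right self-injective ring, if `eR` has simple socle covered by `fR`, then the socle of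
`Rf` receives a nonzero map from `Re`. -/
theorem exists_ne_zero_left_of_right [Module.Injective Rᵐᵒᵖ R] {e f : R}
    (he : IsIdempotentElem e) (hf : IsIdempotentElem f)
    (hs : IsSimpleModule Rᵐᵒᵖ (moduleSocle Rᵐᵒᵖ (principalRight e)))
    (h : ∃ φ : principalRight f →ₗ[Rᵐᵒᵖ] moduleSocle Rᵐᵒᵖ (principalRight e), φ ≠ 0) :
    ∃ φ : Submodule.span R {e} →ₗ[R] moduleSocle R (Submodule.span R {f}), φ ≠ 0 := by
  have : Module.Injective Rᵐᵒᵖ Rᵐᵒᵖ :=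
    .of_linearEquiv (MulOpposite.opLinearEquiv Rᵐᵒᵖ : R ≃ₗ[Rᵐᵒᵖ] Rᵐᵒᵖ)
  obtain ⟨φ, hφ⟩ := h
  obtain ⟨s, hs0, hsf⟩ : ∃ s : moduleSocle Rᵐᵒᵖ (principalRight e),
      s ≠ 0 ∧ MulOpposite.op f • s = s := by
    refine ⟨φ ⟨f, Submodule.mem_span_singleton_self f⟩, fun h0 ↦ hφ (LinearMap.ext ?_), ?_⟩
    · rintro ⟨x, hx⟩
      obtain ⟨t, rfl⟩ := Submodule.mem_span_singleton.1 hx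
      have : (⟨t • f, hx⟩ : principalRight f) = t • ⟨f, Submodule.mem_span_singleton_self f⟩ := rfl
      rw [this, map_smul, h0, smul_zero, LinearMap.zero_apply]
    · rw [← map_smul]
      exact congrArg φ (Subtype.ext hf)
  obtain ⟨x, hxs⟩ : ∃ x : R, x = ((s : principalRight e) : R) := ⟨_, rfl⟩
  have hxf : x * f = x := by
    rw [hxs, ← op_smul_eq_mul, ← Submodule.coe_smul, ← Submodule.coe_smul, hsf]
  have hex : e * x = x := by
    obtain ⟨t, ht⟩ := Submodule.mem_span_singleton.1 (s : principalRight e).2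
    rw [hxs, ← ht, ← MulOpposite.op_unop t, op_smul_eq_mul, ← mul_assoc, he.eq]
  have hx0 : x ≠ 0 := fun h0 ↦ hs0 (Subtype.ext (Subtype.ext (hxs.symm.trans h0)))
  have hxy : ∀ y, x * y ≠ 0 → ∃ z, x * y * z = x := by
    intro y hy
    have hne : MulOpposite.op y • s ≠ 0 := fun h0 ↦ hy (by
      rw [hxs, ← op_smul_eq_mul, ← Submodule.coe_smul, ← Submodule.coe_smul, h0]; rfl)
    obtain ⟨z, hz⟩ := (isSimpleModule_iff_toSpanSingleton_surjective.1 hs).2 _ hne s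
    refine ⟨z.unop, ?_⟩
    rw [hxs]
    exact congrArg (fun w : moduleSocle Rᵐᵒᵖ (principalRight e) ↦ ((w : principalRight e) : R)) hz
  let x' : Submodule.span R {f} := ⟨x, hf.mem_span_singleton_iff.2 hxf⟩
  have hsimple : IsSimpleModule R (Submodule.span R {x'}) := by
    refine isSimpleModule_span_singleton (fun h0 ↦ hx0 (congrArg Subtype.val h0)) fun r hr ↦ ?_
    have hrx : r * x ≠ 0 := fun h0 ↦ hr (Subtype.ext h0)
    -- As `x R` is simple and `r * x ≠ 0`, the elements `r * x` and `x` have the same right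
    -- annihilator; right self-injectivity then writes `x` as a left multiple of `r * x`.
    obtain ⟨t, ht⟩ := exists_mul_of_forall_mul_eq_zero (MulOpposite.op (r * x)) (MulOpposite.op x)
      fun y hy ↦ by
        by_contra hne
        obtain ⟨z, hz⟩ := hxy y.unop fun h0 ↦ hne (MulOpposite.unop_injective h0)
        have h1 : r * x * y.unop = 0 := congrArg MulOpposite.unop hy
        apply hrx
        rw [← hz, ← mul_assoc, ← mul_assoc, h1, zero_mul]
    exact ⟨t.unop, Subtype.ext (congrArg MulOpposite.unop ht).symm⟩
  have hmem : x' ∈ moduleSocle R (Submodule.span R {f}) :=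
    (le_sSup hsimple : Submodule.span R {x'} ≤ moduleSocle R _)
      (Submodule.mem_span_singleton_self x')
  refine he.exists_ne_zero_iff.2 ⟨⟨x', hmem⟩, fun h0 ↦ hx0 ?_⟩
  rw [← hex]
  exact congrArg (fun w : moduleSocle R (Submodule.span R {f}) ↦
    ((w : Submodule.span R {f}) : R)) h0

end LeftRight

/-! ### The Nakayama permutation and the equivalences. -/

namespace PrincipalDecomposition

variable {R : Type u} [Ring R]

/-- `S (π i)` is the only simple quotient of `U (π i)` up to isomorphism, so a nonzero map to the
simple socle identifies the two. -/
theorem isNakayamaPermutation_iff (h : IsQuasiFrobenius R) (D : PrincipalDecomposition R)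
    (π : Equiv.Perm (Fin D.s)) : D.IsNakayamaPermutation π ↔
      ∀ i, ∃ f : D.U (π i) →ₗ[Rᵐᵒᵖ] moduleSocle Rᵐᵒᵖ (D.U i), f ≠ 0 := by
  have := h.injective_right
  have := h.isSemiprimaryRing_op
  have hU := D.isPrincipalFamily_right
  refine forall_congr' fun i ↦ ⟨fun ⟨e⟩ ↦ ?_, fun ⟨f, hf⟩ ↦ ?_⟩
  · refine ⟨(e.symm : D.S (π i) →ₗ[Rᵐᵒᵖ] _) ∘ₗ principalRightToResidue (D.rep (π i)), fun h0 ↦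
      principalRightToResidue_ne_zero (D.primitive ⟨π i, ⟨0, D.mult_pos _⟩⟩)
        (LinearMap.ext fun x ↦ ?_)⟩
    exact e.symm.injective ((LinearMap.congr_fun h0 x).trans (map_zero e.symm).symm)
  · have := hU.isSimpleModule_socle i
    have : IsSimpleModule Rᵐᵒᵖ (D.S (π i)) :=
      isSimpleModule_residueRight (D.primitive ⟨π i, ⟨0, D.mult_pos _⟩⟩) (hU.isLocal (π i))
    exact (hU.isLocal (π i)).nonempty_equiv_of_ne_zero (S := moduleSocle Rᵐᵒᵖ (D.U i)) hf
      (principalRightToResidue_ne_zero (D.primitive ⟨π i, ⟨0, D.mult_pos _⟩⟩))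

theorem existsUnique_isNakayamaPermutation (h : IsQuasiFrobenius R)
    (D : PrincipalDecomposition R) : ∃! π : Equiv.Perm (Fin D.s), D.IsNakayamaPermutation π := by
  have := h.injective_right
  have := h.isSemiprimaryRing_op
  have hU := D.isPrincipalFamily_right
  simp only [D.isNakayamaPermutation_iff h]
  obtain ⟨π, hπ⟩ := hU.exists_perm
  refine ⟨π, hπ, fun σ hσ ↦ Equiv.ext fun i ↦ ?_⟩
  have := hU.isSimpleModule_socle i
  obtain ⟨f, hf⟩ := hσ i
  obtain ⟨g, hg⟩ := hπ i
  exact hU.eq_of_ne_zero (S := moduleSocle Rᵐᵒᵖ (D.U i)) hf hg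

theorem isRightStronglyDualKasch_iff (h : IsQuasiFrobenius R) {D : PrincipalDecomposition R}
    {π : Equiv.Perm (Fin D.s)} (hπ : D.IsNakayamaPermutation π) :
    IsRightStronglyDualKasch R ↔ π = 1 := by
  have := h.injective_right
  have := h.isSemiprimaryRing_op
  have hU := D.isPrincipalFamily_right
  rw [D.isNakayamaPermutation_iff h] at hπ
  rw [IsRightStronglyDualKasch, hU.simplesAreImagesOfHulls_iff]
  constructor
  · refine fun hK ↦ Equiv.ext fun i ↦ ?_
    have := hU.isSimpleModule_socle i
    obtain ⟨f, hf⟩ := hπ i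
    obtain ⟨g, hg⟩ := hK i
    exact hU.eq_of_ne_zero (S := moduleSocle Rᵐᵒᵖ (D.U i)) hf hg
  · rintro rfl
    exact hπ

theorem isLeftStronglyDualKasch_iff (h : IsQuasiFrobenius R) {D : PrincipalDecomposition R}
    {π : Equiv.Perm (Fin D.s)} (hπ : D.IsNakayamaPermutation π) :
    IsLeftStronglyDualKasch R ↔ π = 1 := by
  have := h.injective_left
  have := h.injective_right
  have := h.isSemiprimaryRing
  have := h.isSemiprimaryRing_op
  have hU := D.isPrincipalFamily_right
  have hV := D.isPrincipalFamily_left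
  rw [D.isNakayamaPermutation_iff h] at hπ
  -- On the left, `R e_i` covers the socle of `R e_{π i}`: the permutation there is inverse to `π`.
  have hπ' := fun i ↦ exists_ne_zero_left_of_right (D.primitive ⟨i, ⟨0, D.mult_pos _⟩⟩).1
    (D.primitive ⟨π i, ⟨0, D.mult_pos _⟩⟩).1 (hU.isSimpleModule_socle i) (hπ i)
  rw [IsLeftStronglyDualKasch, hV.simplesAreImagesOfHulls_iff]
  constructor
  · refine fun hK ↦ Equiv.ext fun i ↦ ?_
    have := hV.isSimpleModule_socle (π i)
    obtain ⟨f, hf⟩ := hπ' i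
    obtain ⟨g, hg⟩ := hK (π i)
    exact hV.eq_of_ne_zero hg hf
  · rintro rfl
    exact hπ'

end PrincipalDecomposition

theorem IsQuasiFrobenius.nonempty_principalDecomposition {R : Type u} [Ring R]
    (h : IsQuasiFrobenius R) : Nonempty (PrincipalDecomposition R) :=
  have := h.isSemiprimaryRing
  _root_.nonempty_principalDecomposition R

theorem IsQuasiFrobenius.isWeaklySymmetric_iff {R : Type u} [Ring R] (h : IsQuasiFrobenius R)
    {p : Prop} (hp : ∀ (D : PrincipalDecomposition R) (π : Equiv.Perm (Fin D.s)),
      D.IsNakayamaPermutation π → (p ↔ π = 1)) : p ↔ IsWeaklySymmetric R := by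
  refine ⟨fun hK ↦ ⟨h, ?_⟩, fun ⟨_, D, π, hπ, h1⟩ ↦ (hp D π hπ).2 h1⟩
  obtain ⟨D⟩ := h.nonempty_principalDecomposition
  obtain ⟨π, hπ, -⟩ := D.existsUnique_isNakayamaPermutation h
  exact ⟨D, π, hπ, (hp D π hπ).1 hK⟩

theorem mainTheorem9 :
    (∀ (R : Type u) [Ring R] [Nontrivial R], IsQuasiFrobenius R →
      Nonempty (PrincipalDecomposition R) ∧
      ∀ D : PrincipalDecomposition R,
        (∃! π : Equiv.Perm (Fin D.s), D.IsNakayamaPermutation π) ∧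
        ∀ π : Equiv.Perm (Fin D.s), D.IsNakayamaPermutation π →
          (IsRightStronglyDualKasch R ↔ π = 1) ∧ (IsLeftStronglyDualKasch R ↔ π = 1)) ∧
    (∀ (k : Type v) [Field k] (A : Type u) [Ring A] [Algebra k A] [Nontrivial A],
      IsQuasiFrobenius A →
        (IsRightStronglyDualKasch A ↔ IsWeaklySymmetric A) ∧
        (IsLeftStronglyDualKasch A ↔ IsWeaklySymmetric A)) :=
  ⟨fun _ _ _ h ↦ ⟨h.nonempty_principalDecomposition, fun D ↦
    ⟨D.existsUnique_isNakayamaPermutation h, fun _ hπ ↦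
      ⟨D.isRightStronglyDualKasch_iff h hπ, D.isLeftStronglyDualKasch_iff h hπ⟩⟩⟩,
  fun _ _ _ _ _ _ h ↦
    ⟨h.isWeaklySymmetric_iff fun _ _ hπ ↦ PrincipalDecomposition.isRightStronglyDualKasch_iff h hπ,
      h.isWeaklySymmetric_iff fun _ _ hπ ↦
        PrincipalDecomposition.isLeftStronglyDualKasch_iff h hπ⟩⟩
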